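/- Let $(M,\omega,\mathbb{T})$ be a compact connected symplectic toric manifold of real dimension $2m$, that is, a compact connected symplectic manifold with an effective action of the $m$-dimensional torus $\mathbb{T}$ which is hamiltonian with $\mathbb{T}$-invariant moment map $\mu:M\to\mathfrak{t}^*$ (so $\omega(\xi^\sharp,\cdot)=-d\mu^{\xi}$ for $\xi\in\mathfrak{t}$, where $\xi^\sharp$ is the infinitesimal action of $\xi$). Let $\Delta=\mu(M)$, let $\mathring{\Delta}$ be its interior in $\mathfrak{t}^*$ and $\mathring{M}=\mu^{-1}(\mathring{\Delta})$. Fix a basis $(\xi_1,\dots,\xi_m)$ of $\mathfrak{t}$; put $K_j=\xi_j^\sharp$, $\mu^j=\mu^{\xi_j}$, and let $\mathcal{K}$ be the distribution spanned by the $K_j$ on $\mathring{M}$. For an invariant open set $U\subseteq M$ (here $U=M$ or $U=\mathring{M}$), $DGAK^{\mathbb{T}}_\omega(U)$ is the set of smooth $\mathbb{T}$-invariant almost complex structures $J$ on $U$ which are $\omega$-tamed ($\omega(v,Jv)>0$ for $v\neq 0$) and satisfy $J^{*_\omega}\mathcal{K}=J\mathcal{K}$ on $U\cap\mathring{M}$,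 where $\omega(J\cdot,\cdot)=\omega(\cdot,J^{*_\omega}\cdot)$; and $DGK^{\mathbb{T}}_\omega(U)$ is the set of those $J\in DGAK^{\mathbb{T}}_\omega(U)$ for which both $J$ and $J^{*_\omega}$ are integrable. An element $J_0\in DGK^{\mathbb{T}}_\omega(M)$ induces admissible coordinates $(\mu^j,t^j)$, locally on $\mathring{M}$: the forms $dt^j$ are determined on $\mathring{M}$ by $dt^i(K_j)=\delta_{ij}$ and $dt^i(J_0K_j)=0$, and $(\partial/\partial\mu^j,\partial/\partial t^j=K_j)$ is the frame dual to $(d\mu^j,dt^j)$. Fix admissible coordinates $(\mu^j,t^j)$. Let $J\in DGK^{\mathbb{T}}_\omega(M)$ and $\mathring{J}\in DGAK^{\mathbb{T}}_\omega(\mathring{M})$ be given on $\mathring{M}$ by $$J=\sum_{i,j}\Psi_{ij}\frac{\partial}{\partial t^i}\otimes d\mu^j-\sum_{i,j}(\Psi^{-1})_{ij}\frac{\partial}{\partial\mu^i}\otimes dt^j,\qquad \mathring{J}=\sum_{i,j}\mathring{\Psi}_{ij}\frac{\partial}{\partial t^i}\otimes d\mu^j-\sum_{i,j}(\mathring{\Psi}^{-1})_{ij}\frac{\partial}{\partial\mu^i}\otimes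 dt^j .$$ Suppose that (C1) $\mathring{\Psi}-\Psi$ extends smoothly to $\Delta$, i.e. there is a smooth matrix-valued function $A$ on $\mathfrak{t}^*$ with $\mathring{\Psi}-\Psi=A\circ\mu$ on $\mathring{M}$; (C2) $\Psi^T\mathring{\Psi}^{-1}\Psi-\Psi^T$ extends smoothly to $\Delta$, i.e. there is a smooth matrix-valued function $B$ on $\mathfrak{t}^*$ with $\Psi^T\mathring{\Psi}^{-1}\Psi-\Psi^T=B\circ\mu$ on $\mathring{M}$; (C3) the bilinear form $\omega(\cdot,J\cdot)+\sum_{i,j}(A_{ij}\circ\mu)\,d\mu^i\otimes d\mu^j+\sum_{i,j}(B_{ij}\circ\mu)\,(Jd\mu^i)\otimes(Jd\mu^j)$, where $J\alpha=-\alpha\circ J$ for a 1-form $\alpha$, is positive definite at every point of $M\setminus\mathring{M}$. Then $\mathring{J}$ is the restriction to $\mathring{M}$ of an element of $DGAK^{\mathbb{T}}_\omega(M)$, which belongs to $DGK^{\mathbb{T}}_\omega(M)$ if $\mathring{J}\in DGK^{\mathbb{T}}_\omega(\mathring{M})$. -/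

import Mathlib

open Bundle Set
open scoped Manifold ContDiff Matrix

/-- The `m`-dimensional torus `(S¹)^m`, with Lie algebra `ℝ^m`. -/
abbrev Torus (m : ℕ) : Type := Fin m → Circle

/-- The Lie algebra `𝔱 = ℝ^m` of the torus. -/
abbrev TorusLie (m : ℕ) : Type := Fin m → ℝ

/-- The dual `𝔱*` of the Lie algebra of the torus. -/
abbrev TorusLieDual (m : ℕ) : Type := StrongDual ℝ (TorusLie m)

/-- The exponential map `𝔱 → 𝕋`, a smooth covering homomorphism. -/
noncomputable def torusExp {m : ℕ} (s : TorusLie m) : Torus m := fun j => Circle.exp (s j)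

section LinearAlgebra

variable {V : Type*} [AddCommGroup V] [Module ℝ V] [TopologicalSpace V]

/-- The symplectic adjoint `A^{*Ω}` of an endomorphism `A`, that is `Ω⁻¹ ∘ Aᵗ ∘ Ω` where `Ω` is seen
as the isomorphism `X ↦ Ω(X, ·)` and `Aᵗ α = α ∘ A`. For a nondegenerate 2-form on a
finite-dimensional space it is characterized by `Ω(A X, Y) = Ω(X, A^{*Ω} Y)`. -/
noncomputable def symplecticAdjoint [IsTopologicalAddGroup V] [ContinuousSMul ℝ V]
    (Ω : V →L[ℝ] V →L[ℝ] ℝ) (A : V →L[ℝ] V) : V →L[ℝ] V :=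
  Ω.inverse ∘L (ContinuousLinearMap.precomp ℝ A) ∘L Ω

open Classical in
/-- The `i`-th covector of the coframe dual to the frame `e`
(it is the usual dual basis when `e` is a basis). -/
noncomputable def dualCovector {ι : Type*} (e : ι → V) (i : ι) : V →L[ℝ] ℝ :=
  if h : ∃ α : V →L[ℝ] ℝ, ∀ j, α (e j) = if j = i then 1 else 0 then h.choose else 0

open Classical in
/-- The `i`-th vector of the frame dual to the coframe `θ`
(it is the usual dual basis when `θ` is a basis of the dual space). -/
noncomputable def dualVector {ι : Type*} (θ : ι → V →L[ℝ] ℝ) (i : ι) : V :=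
  if h : ∃ v : V, ∀ j, θ j v = if j = i then 1 else 0 then h.choose else 0

end LinearAlgebra

section Tensors

variable (m : ℕ) (M : Type*) [TopologicalSpace M] [ChartedSpace (EuclideanSpace ℝ (Fin (2 * m))) M]

/-- Vector fields on the `2m`-manifold `M` (no regularity). -/
abbrev VField : Type _ := ∀ x : M, TangentSpace (𝓡 (2 * m)) x

/-- Covariant 2-tensors on the `2m`-manifold `M` (no regularity). -/
abbrev BilinField : Type _ :=
  ∀ x : M, TangentSpace (𝓡 (2 * m)) x →L[ℝ] TangentSpace (𝓡 (2 * m)) x →L[ℝ] ℝ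

/-- Fields of endomorphisms of the tangent bundle of the `2m`-manifold `M` (no regularity). -/
abbrev EndField : Type _ :=
  ∀ x : M, TangentSpace (𝓡 (2 * m)) x →L[ℝ] TangentSpace (𝓡 (2 * m)) x

variable {m M} [IsManifold (𝓡 (2 * m)) ∞ M]

/-- The vector field `X` is smooth on `U`. -/
def VField.SmoothOn (X : VField m M) (U : Set M) : Prop :=
  ContMDiffOn (𝓡 (2 * m)) ((𝓡 (2 * m)).prod (𝓡 (2 * m))) ∞
    (fun x => TotalSpace.mk' (EuclideanSpace ℝ (Fin (2 * m))) x (X x)) U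

/-- The covariant 2-tensor `b` is smooth on `U`, as a section of a hom bundle. -/
def BilinField.SmoothOn (b : BilinField m M) (U : Set M) : Prop :=
  ContMDiffOn (𝓡 (2 * m)) ((𝓡 (2 * m)).prod
      𝓘(ℝ, EuclideanSpace ℝ (Fin (2 * m)) →L[ℝ] EuclideanSpace ℝ (Fin (2 * m)) →L[ℝ] ℝ)) ∞
    (fun x => TotalSpace.mk'
      (EuclideanSpace ℝ (Fin (2 * m)) →L[ℝ] EuclideanSpace ℝ (Fin (2 * m)) →L[ℝ] ℝ)
      (E := fun x : M =>
        TangentSpace (𝓡 (2 * m)) x →L[ℝ] TangentSpace (𝓡 (2 * m)) x →L[ℝ] ℝ) x (b x)) U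

/-- The field of endomorphisms `J` is smooth on `U`, as a section of a hom bundle. -/
noncomputable def EndField.SmoothOn (J : EndField m M) (U : Set M) : Prop :=
  ContMDiffOn (𝓡 (2 * m)) ((𝓡 (2 * m)).prod
      𝓘(ℝ, EuclideanSpace ℝ (Fin (2 * m)) →L[ℝ] EuclideanSpace ℝ (Fin (2 * m)))) ∞
    (fun x => TotalSpace.mk'
      (EuclideanSpace ℝ (Fin (2 * m)) →L[ℝ] EuclideanSpace ℝ (Fin (2 * m)))
      (E := fun x : M =>
        TangentSpace (𝓡 (2 * m)) x →L[ℝ] TangentSpace (𝓡 (2 * m)) x) x (J x)) U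

/-- The differential of the 2-form `Ω`, evaluated on three vector fields. -/
noncomputable def dTwoForm (Ω : BilinField m M) (X Y Z : VField m M) (x : M) : ℝ :=
  mvfderiv (𝓡 (2 * m)) (fun y => Ω y (Y y) (Z y)) x (X x)
    + mvfderiv (𝓡 (2 * m)) (fun y => Ω y (Z y) (X y)) x (Y x)
    + mvfderiv (𝓡 (2 * m)) (fun y => Ω y (X y) (Y y)) x (Z x)
    - Ω x (VectorField.mlieBracket (𝓡 (2 * m)) X Y x) (Z x)
    - Ω x (VectorField.mlieBracket (𝓡 (2 * m)) Y Z x) (X x)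
    - Ω x (VectorField.mlieBracket (𝓡 (2 * m)) Z X x) (Y x)

/-- The vector field `J X`. -/
noncomputable def EndField.app (J : EndField m M) (X : VField m M) : VField m M := fun x => J x (X x)

/-- The Nijenhuis tensor `[JX, JY] - J[JX, Y] - J[X, JY] - [X, Y]`. -/
noncomputable def nijenhuis (J : EndField m M) (X Y : VField m M) (x : M) :
    TangentSpace (𝓡 (2 * m)) x :=
  VectorField.mlieBracket (𝓡 (2 * m)) (J.app X) (J.app Y) x
    - J x (VectorField.mlieBracket (𝓡 (2 * m)) (J.app X) Y x)
    - J x (VectorField.mlieBracket (𝓡 (2 * m)) X (J.app Y) x)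
    - VectorField.mlieBracket (𝓡 (2 * m)) X Y x

/-- Integrability, on the open set `U`, of an almost complex structure `J`. -/
def EndField.IntegrableOn (J : EndField m M) (U : Set M) : Prop :=
  ∀ X Y : VField m M, X.SmoothOn U → Y.SmoothOn U → ∀ x ∈ U, nijenhuis J X Y x = 0

/-- The infinitesimal action `ξ♯` on `M` of `ξ ∈ 𝔱`: the velocity at time `0` of
`s ↦ exp(s ξ) • x`. -/
noncomputable def fundamentalField [MulAction (Torus m) M] (ξ : TorusLie m) : VField m M :=
  fun x => (mfderiv 𝓘(ℝ, ℝ) (𝓡 (2 * m)) (fun s : ℝ => torusExp (s • ξ) • x) 0 (1 : ℝ) :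
    EuclideanSpace ℝ (Fin (2 * m)))

variable (m M) in
/-- The data of a symplectic form `Ω` and a moment map `μ` making the `2m`-manifold `M`, with its
given action of the `m`-torus, a symplectic toric manifold (compactness, connectedness and the
Hausdorff property of `M` are to be assumed separately). -/
structure SymplecticToric [MulAction (Torus m) M] where
  /-- the symplectic form -/
  Ω : BilinField m M
  Ω_smooth : Ω.SmoothOn univ
  Ω_alternating : ∀ x v, Ω x v v = 0
  Ω_nondegenerate : ∀ x v, (∀ w, Ω x v w = 0) → v = 0
  Ω_closed : ∀ X Y Z : VField m M, X.SmoothOn univ → Y.SmoothOn univ → Z.SmoothOn univ →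
    ∀ x, dTwoForm Ω X Y Z x = 0
  /-- the action is smooth (tested on the universal cover `𝔱 → 𝕋`) -/
  action_smooth : ContMDiff (𝓘(ℝ, TorusLie m).prod (𝓡 (2 * m))) (𝓡 (2 * m)) ∞
    (fun p : TorusLie m × M => torusExp p.1 • p.2)
  action_effective : ∀ g : Torus m, (∀ x : M, g • x = x) → g = 1
  action_symplectic : ∀ (g : Torus m) (x : M) (v w : TangentSpace (𝓡 (2 * m)) x),
    Ω (g • x) (mfderiv (𝓡 (2 * m)) (𝓡 (2 * m)) (fun y : M => g • y) x v)
      (mfderiv (𝓡 (2 * m)) (𝓡 (2 * m)) (fun y : M => g • y) x w) = Ω x v w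
  /-- the moment map -/
  μ : M → TorusLieDual m
  μ_smooth : ContMDiff (𝓡 (2 * m)) 𝓘(ℝ, TorusLieDual m) ∞ μ
  μ_invariant : ∀ (g : Torus m) (x : M), μ (g • x) = μ x
  /-- `ξ♯` is the symplectic gradient `-Ω⁻¹(dμ^ξ)` of `μ^ξ` -/
  μ_hamiltonian : ∀ (ξ : TorusLie m) (x : M) (v : TangentSpace (𝓡 (2 * m)) x),
    Ω x (fundamentalField ξ x) v = - mvfderiv (𝓡 (2 * m)) (fun y => μ y ξ) x v

end Tensors

namespace SymplecticToric

variable {m : ℕ} {M : Type*} [TopologicalSpace M] [ChartedSpace (EuclideanSpace ℝ (Fin (2 * m))) M]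
  [IsManifold (𝓡 (2 * m)) ∞ M] [MulAction (Torus m) M] (S : SymplecticToric m M)

/-- The moment polytope `Δ = μ(M)`. -/
def polytope : Set (TorusLieDual m) := range S.μ

/-- The preimage `M°` of the interior of the moment polytope. -/
def regular : Set M := S.μ ⁻¹' interior S.polytope

/-- The field of symplectic adjoints `J^{*Ω}`. -/
noncomputable def adjoint (J : EndField m M) : EndField m M :=
  fun x => symplecticAdjoint (S.Ω x) (J x)

/-- The tangent space `𝒦` at `x` to the orbit through `x`, spanned by the infinitesimal actions. -/
noncomputable def orbitDistribution (_S : SymplecticToric m M) (x : M) :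
    Submodule ℝ (TangentSpace (𝓡 (2 * m)) x) :=
  Submodule.span ℝ (range fun ξ : TorusLie m => fundamentalField ξ x)

/-- `J` restricts to an element of `GAK^𝕋_Ω(U)`, for `U` an invariant open set: a smooth
`𝕋`-invariant `Ω`-tamed almost complex structure on `U`. Nothing is said outside `U`. -/
structure IsGAK (U : Set M) (J : EndField m M) : Prop where
  smooth : J.SmoothOn U
  sq : ∀ x ∈ U, ∀ v, J x (J x v) = -v
  tamed : ∀ x ∈ U, ∀ v, v ≠ 0 → 0 < S.Ω x v (J x v)
  invariant : ∀ (g : Torus m), ∀ x ∈ U, ∀ v,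
    J (g • x) (mfderiv (𝓡 (2 * m)) (𝓡 (2 * m)) (fun y : M => g • y) x v)
      = mfderiv (𝓡 (2 * m)) (𝓡 (2 * m)) (fun y : M => g • y) x (J x v)

/-- `J` restricts to an element of `GK^𝕋_Ω(U)`: both `J` and `J^{*Ω}` are integrable. -/
structure IsGK (U : Set M) (J : EndField m M) : Prop extends S.IsGAK U J where
  integrable : J.IntegrableOn U
  integrable_adjoint : (S.adjoint J).IntegrableOn U

/-- The condition `J^{*Ω} 𝒦 = J 𝒦` on the part of `U` over the interior of the polytope. -/
def AdjointAligned (U : Set M) (J : EndField m M) : Prop :=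
  ∀ x ∈ U ∩ S.regular,
    (S.orbitDistribution x).map (S.adjoint J x).toLinearMap
      = (S.orbitDistribution x).map (J x).toLinearMap

/-- `J` restricts to an element of `DGAK^𝕋_Ω(U)`. -/
def IsDGAK (U : Set M) (J : EndField m M) : Prop := S.IsGAK U J ∧ S.AdjointAligned U J

/-- `J` restricts to an element of `DGK^𝕋_Ω(U)`. -/
def IsDGK (U : Set M) (J : EndField m M) : Prop := S.IsGK U J ∧ S.AdjointAligned U J

variable (ξ : Module.Basis (Fin m) ℝ (TorusLie m))

/-- The 1-form `dμ^i`, where `μ^i = μ^{ξ_i}`. -/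
noncomputable def dmu (i : Fin m) (x : M) : TangentSpace (𝓡 (2 * m)) x →L[ℝ] ℝ :=
  mvfderiv (𝓡 (2 * m)) (fun y => S.μ y (ξ i)) x

/-- The coordinate 1-form `dt^i` on `M°` of the angular coordinates induced by `J₀`: the coordinates
`(u^j, t^j)` are those with `∂/∂u^j = -J₀ K_j` and `∂/∂t^j = K_j`, where `K_j = ξ_j♯`, so that
`(du^j, dt^j)` is the dual coframe of the frame `(-J₀ K_j, K_j)`. -/
noncomputable def dt (_S : SymplecticToric m M) (J₀ : EndField m M) (i : Fin m) (x : M) :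
    TangentSpace (𝓡 (2 * m)) x →L[ℝ] ℝ :=
  dualCovector
    (Sum.elim (fun j : Fin m => -(J₀ x (fundamentalField (ξ j) x)))
      (fun j : Fin m => fundamentalField (ξ j) x)) (Sum.inr i)

/-- The coordinate vector field `∂/∂μ^i` on `M°` of the coordinates `(μ^j, t^j)` induced by `J₀`,
from the frame dual to `(dμ^j, dt^j)`. (The field `∂/∂t^i` of that frame is `K_i`.) -/
noncomputable def partialMu (J₀ : EndField m M) (i : Fin m) : VField m M := fun x =>
  dualVector (Sum.elim (fun j : Fin m => S.dmu ξ j x) (fun j : Fin m => S.dt ξ J₀ j x)) (Sum.inl i)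

/-- On `M°`, `J` has the anti-diagonal form
`∑ Ψ_{ij} ∂/∂t^i ⊗ dμ^j - ∑ (Ψ⁻¹)_{ij} ∂/∂μ^i ⊗ dt^j`
with respect to the coordinates `(μ^j, t^j)` induced by `J₀`. -/
def HasAntiDiagonalForm (J₀ J : EndField m M) (Ψ : M → Matrix (Fin m) (Fin m) ℝ) : Prop :=
  ∀ x ∈ S.regular, ∀ v : TangentSpace (𝓡 (2 * m)) x,
    J x v = ∑ i, ∑ j, (Ψ x i j * S.dmu ξ j x v) • fundamentalField (ξ i) x
      - ∑ i, ∑ j, ((Ψ x)⁻¹ i j * S.dt ξ J₀ j x v) • S.partialMu ξ J₀ i x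

/-- The matrix-valued function `F` on `M°` extends smoothly to `Δ`, by the restriction to `Δ` of the
smooth function `A` on `𝔱*` (functions on `Δ` being identified with their pullbacks by `μ`). -/
def IsSmoothExtension (F : M → Matrix (Fin m) (Fin m) ℝ)
    (A : TorusLieDual m → Matrix (Fin m) (Fin m) ℝ) : Prop :=
  (∀ i j, ContDiff ℝ ∞ (fun p => A p i j)) ∧ ∀ x ∈ S.regular, F x = A (S.μ x)

/-- The quadratic form, at `x`, of the bilinear form
`Ω(·, J ·) + ∑ A_{ij} dμ^i ⊗ dμ^j + ∑ B_{ij} (J dμ^i) ⊗ (J dμ^j)`, where `J α = -α ∘ J`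
for a 1-form `α`. -/
noncomputable def compactifiedForm (J : EndField m M)
    (A B : TorusLieDual m → Matrix (Fin m) (Fin m) ℝ) (x : M)
    (v : TangentSpace (𝓡 (2 * m)) x) : ℝ :=
  S.Ω x v (J x v)
    + ∑ i, ∑ j, A (S.μ x) i j * S.dmu ξ i x v * S.dmu ξ j x v
    + ∑ i, ∑ j, B (S.μ x) i j * (-S.dmu ξ i x (J x v)) * (-S.dmu ξ j x (J x v))

end SymplecticToric

/-! The bilinear form in (C3) is smooth on all of `M`, because `J`, `dμ`, `A ∘ μ` and `B ∘ μ` are.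
As `Ω` is nondegenerate, the form equals `Ω(·, J̃ ·)` for a unique smooth field `J̃`, the
`compactification`, and this is the extension. In a Darboux frame `Ω(v, J w)` is block diagonal,
with `Ψ` on the `dμ` components and `Ψ⁻¹` on the `dt` components, and `dμ ∘ J = -Ψ⁻¹ dt`. The `A`
term therefore replaces `Ψ` by `Ψreg`. The `B` term is a congruence by `Ψ⁻¹`, which turns `ΨᵀΨreg⁻¹Ψ
- Ψᵀ` into `Ψreg⁻¹ - Ψ⁻¹` and so replaces `Ψ⁻¹` by `Ψreg⁻¹`. This is `compactifiedBilin_eq`.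

The rest passes from `M°` to `M`. The equation `J̃² = -1` and the vanishing of the Nijenhuis tensors
are closed conditions. Taming is inherited from `Jreg` on `M°` and is (C3) elsewhere. Invariance
holds because every ingredient is invariant, and alignment only concerns `M°`.

What remains is the density of `M°`, obtained without convexity or normal forms. Where the
stabilizer is discrete, `dμ` is onto, so the point lies over the interior of the polytope
(`mem_regular_of_locallyFree`). A point with a nondiscrete stabilizer is fixed by a circle, hence by
a nontrivial torsion element taken from a countable list. By effectiveness and the rigidity of
finite-order maps each such fixed set has empty interior, and Baire's theorem gives
`dense_locallyFree`. Frames are used only at locally free points; continuity covers the rest of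
`M°`. -/

/-! ### Closed subgroups of `ℝ^m` containing `ℤ^m`. -/

/-- A closed subgroup of a finite-dimensional space which contains no line is discrete. -/
theorem discreteTopology_of_isClosed_of_no_line {E : Type*} [NormedAddCommGroup E] [NormedSpace ℝ E]
    [FiniteDimensional ℝ E] (D : AddSubgroup E) (hD : IsClosed (D : Set E))
    (hline : ∀ v : E, (∀ t : ℝ, t • v ∈ D) → v = 0) : DiscreteTopology D := by
  by_contra hnd
  have hacc : ∀ n : ℕ, ∃ v ∈ D, v ≠ 0 ∧ ‖v‖ < 1 / ((n : ℝ) + 1) := by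
    by_contra! hcon
    obtain ⟨n, hn⟩ := hcon
    apply hnd
    rw [discreteTopology_iff_isOpen_singleton_zero, Metric.isOpen_singleton_iff]
    refine ⟨1 / ((n : ℝ) + 1), by positivity, fun y hy => ?_⟩
    by_contra hy0
    have := hn y y.2 (by simpa using hy0)
    rw [dist_zero_right] at hy
    exact absurd hy (not_lt.2 this)
  choose v hvD hv0 hv using hacc
  have hlim : Filter.Tendsto (fun n => ‖v n‖) Filter.atTop (nhds 0) :=
    squeeze_zero (fun _ => norm_nonneg _) (fun n => (hv n).le) tendsto_one_div_add_atTop_nhds_zero_nat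
  have hmem : ∀ n, (‖v n‖⁻¹ • v n) ∈ Metric.sphere (0 : E) 1 := fun n => by
    simp [norm_smul, inv_mul_cancel₀ (norm_ne_zero_iff.2 (hv0 n))]
  obtain ⟨u, hu, φ, hφ, hlimu⟩ := (isCompact_sphere (0 : E) 1).tendsto_subseq hmem
  have hu0 : u = 0 := by
    refine hline u fun t => ?_
    -- `u` is a limit of directions of short elements of `D`. Rounding `t / ‖v‖` to an integer
    -- multiple of `v` approximates `t • u` with error tending to `0`.
    have hlim' : Filter.Tendsto (fun k => ((⌊t * ‖v (φ k)‖⁻¹⌋ : ℤ) * ‖v (φ k)‖ : ℝ))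
        Filter.atTop (nhds t) := by
      rw [tendsto_iff_dist_tendsto_zero]
      refine squeeze_zero (fun _ => dist_nonneg) (fun k => ?_) (hlim.comp hφ.tendsto_atTop)
      have hpos : 0 < ‖v (φ k)‖ := norm_pos_iff.2 (hv0 _)
      have h1 := Int.floor_le (t * ‖v (φ k)‖⁻¹)
      have h2 := (Int.lt_floor_add_one (t * ‖v (φ k)‖⁻¹)).le
      have h3 : t * ‖v (φ k)‖⁻¹ * ‖v (φ k)‖ = t := by field_simp
      have h4 := mul_le_mul_of_nonneg_right h1 hpos.le
      have h5 := mul_le_mul_of_nonneg_right h2 hpos.le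
      rw [Real.dist_eq, abs_le]
      simp only [Function.comp]
      constructor <;> nlinarith
    have h6 := hlim'.smul hlimu
    refine hD.mem_of_tendsto h6 (Filter.Eventually.of_forall fun k => ?_)
    have hne : ‖v (φ k)‖ ≠ 0 := norm_ne_zero_iff.2 (hv0 _)
    simp only [Function.comp, SetLike.mem_coe]
    rw [smul_smul, mul_assoc, mul_inv_cancel₀ hne, mul_one, Int.cast_smul_eq_zsmul]
    exact D.zsmul_mem (hvD _) _
  simp [hu0] at hu

/-- A closed subgroup of `ℝ^m` which contains `ℤ^m` and a line contains a line through a nonzero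
integer vector. -/
theorem exists_int_line_of_isClosed {m : ℕ} (L : AddSubgroup (Fin m → ℝ))
    (hL : IsClosed (L : Set (Fin m → ℝ))) (hint : ∀ n : Fin m → ℤ, (fun i => (n i : ℝ)) ∈ L)
    {v : Fin m → ℝ} (hv : v ≠ 0) (hvL : ∀ t : ℝ, t • v ∈ L) :
    ∃ n : Fin m → ℤ, n ≠ 0 ∧ ∀ t : ℝ, t • (fun i => (n i : ℝ)) ∈ L := by
  -- `W` is the largest subspace inside `L`. Modulo `W`, the group `L` becomes a lattice of rank `m
  -- - dim W < m`, so `ℤ^m` cannot inject into it; a kernel element is an integer vector in `W`.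
  let W : Submodule ℝ (Fin m → ℝ) :=
    { carrier := {w | ∀ t : ℝ, t • w ∈ L}
      add_mem' := fun {a b} ha hb t => by rw [smul_add]; exact L.add_mem (ha t) (hb t)
      zero_mem' := fun t => by rw [smul_zero]; exact L.zero_mem
      smul_mem' := fun c w hw t => by rw [smul_smul]; exact hw _ }
  have hWL : ∀ w ∈ W, w ∈ L := fun w hw => by simpa using hw 1
  obtain ⟨W', hW'⟩ := W.exists_isCompl
  let D : AddSubgroup W' := L.comap W'.subtype.toAddMonoidHom
  have hDcl : IsClosed (D : Set W') := hL.preimage continuous_subtype_val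
  have hDdisc : DiscreteTopology D := by
    refine discreteTopology_of_isClosed_of_no_line D hDcl fun w hw => ?_
    have h1 : (w : Fin m → ℝ) ∈ W := fun t => hw t
    exact Subtype.ext ((Submodule.disjoint_def.1 hW'.disjoint) _ h1 w.2)
  let p : (Fin m → ℝ) →ₗ[ℝ] W' := W'.projectionOnto W hW'.symm
  have hpL : ∀ w ∈ L, p w ∈ D := fun w hw => by
    have h1 : w - p w ∈ W := by
      rw [← Submodule.ker_projectionOnto hW'.symm, LinearMap.mem_ker, map_sub]
      exact sub_eq_zero.2 (Submodule.projectionOnto_apply_left hW'.symm (p w)).symm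
    have h2 := L.sub_mem hw (hWL _ h1)
    rw [sub_sub_cancel] at h2
    exact h2
  let DZ : Submodule ℤ W' := AddSubgroup.toIntSubmodule D
  have : DiscreteTopology DZ := hDdisc
  let c : (Fin m → ℤ) →ₗ[ℤ] (Fin m → ℝ) :=
    { toFun := fun n i => (n i : ℝ)
      map_add' := fun a b => by ext; simp
      map_smul' := fun a b => by ext; simp }
  let f : (Fin m → ℤ) →ₗ[ℤ] DZ := LinearMap.codRestrict DZ ((p.restrictScalars ℤ).comp c)
    (fun n => hpL _ (hint n))
  have hspan : IsZLattice ℝ DZ := by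
    constructor
    rw [eq_top_iff]
    rintro w -
    have h1 : w = p w := by simp [p]
    rw [h1, pi_eq_sum_univ (w : Fin m → ℝ), map_sum]
    refine Submodule.sum_mem _ fun i _ => ?_
    rw [map_smul]
    refine Submodule.smul_mem _ _ (Submodule.subset_span (hpL _ ?_))
    convert hint (fun j => if i = j then 1 else 0) using 2
    split_ifs <;> simp
  have hlt : Module.finrank ℤ DZ < Module.finrank ℤ (Fin m → ℤ) := by
    rw [ZLattice.rank ℝ DZ, Module.finrank_fin_fun]
    have h1 := Submodule.finrank_add_eq_of_isCompl hW'
    rw [Module.finrank_fin_fun] at h1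
    have h2 : 0 < Module.finrank ℝ W := by
      have : Nontrivial W := ⟨⟨⟨v, hvL⟩, 0, fun h => hv (congrArg Subtype.val h)⟩⟩
      exact Module.finrank_pos
    omega
  have : Module.Finite ℤ DZ := ZLattice.module_finite ℝ DZ
  have : Module.Free ℤ DZ := ZLattice.module_free ℝ DZ
  have hker : LinearMap.ker f ≠ ⊥ := fun h =>
    absurd (LinearMap.finrank_le_finrank_of_injective (LinearMap.ker_eq_bot.1 h)) (not_le.2 hlt)
  obtain ⟨n, hn, hn0⟩ := Submodule.exists_mem_ne_zero_of_ne_bot hker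
  refine ⟨n, hn0, ?_⟩
  have h1 : p (fun i => (n i : ℝ)) = 0 := congrArg Subtype.val (LinearMap.mem_ker.1 hn)
  have h2 : (fun i => (n i : ℝ)) ∈ W := by
    rw [← Submodule.ker_projectionOnto hW'.symm]; exact h1
  exact h2

/-! ### Rigidity of finite-order maps. -/

/-- A map of finite order on a finite-dimensional manifold, which is the identity on an open set,
is the identity near every point of the closure of that set. -/
theorem eventually_fixed_of_mem_closure {E : Type*} [NormedAddCommGroup E] [NormedSpace ℝ E]
    [FiniteDimensional ℝ E] {M : Type*} [TopologicalSpace M] [T2Space M] [ChartedSpace E M]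
    [IsManifold 𝓘(ℝ, E) ∞ M] {f : M → M} (hf : ContMDiff 𝓘(ℝ, E) 𝓘(ℝ, E) ∞ f)
    {q : ℕ} (hq : q ≠ 0) (hfq : ∀ x, f^[q] x = x) {x : M}
    (hx : x ∈ closure (interior {y | f y = y})) : ∀ᶠ y in nhds x, f y = y := by
  have hclosed : IsClosed {y | f y = y} := isClosed_eq hf.continuous continuous_id
  have hfx : f x = x := closure_minimal interior_subset hclosed hx
  have hiter : ∀ k, f^[k] x = x := fun k => Function.iterate_fixed hfx k
  have hfk : ∀ k, ContMDiff 𝓘(ℝ, E) 𝓘(ℝ, E) ∞ f^[k] := fun k => by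
    induction k with
    | zero => exact contMDiff_id
    | succ k ih => rw [Function.iterate_succ]; exact ih.comp hf
  let φ := extChartAt 𝓘(ℝ, E) x
  -- Summing the chart over the orbit gives an `f`-invariant map. It equals `q • φ` where `f` is the
  -- identity, so by continuity its derivative at `x` is `q • id`. It is thus injective near `x`,
  -- and `ψ (f y) = ψ y` forces `f y = y`.
  let ψ : M → E := fun y => ∑ k ∈ Finset.range q, φ (f^[k] y)
  have hψf : ∀ y, ψ (f y) = ψ y := fun y => by
    have h1 := Finset.sum_range_succ (fun k => φ (f^[k] y)) q
    have h2 := Finset.sum_range_succ' (fun k => φ (f^[k] y)) q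
    simp only [hfq, Function.iterate_succ, Function.comp, Function.iterate_zero, id] at h1 h2
    exact add_right_cancel (h2.symm.trans h1)
  have hψ : ContMDiffAt 𝓘(ℝ, E) 𝓘(ℝ, E) ∞ ψ x := by
    refine contMDiffAt_finsetSum fun k _ => ?_
    refine ContMDiffAt.comp x ?_ (hfk k x)
    rw [hiter k]
    exact contMDiffAt_extChartAt
  let h : E → E := ψ ∘ φ.symm
  have hsymm : ContMDiffAt 𝓘(ℝ, E) 𝓘(ℝ, E) ∞ φ.symm (φ x) :=
    (contMDiffOn_extChartAt_symm x).contMDiffAt (extChartAt_target_mem_nhds x)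
  have hh : ContDiffAt ℝ ∞ h (φ x) := by
    rw [← contMDiffAt_iff_contDiffAt]
    refine ContMDiffAt.comp (φ x) ?_ hsymm
    rw [extChartAt_to_inv]
    exact hψ
  have hfix : ∀ y ∈ interior {y | f y = y}, ∀ k, f^[k] y = y := fun y hy k =>
    Function.iterate_fixed (interior_subset (s := {y | f y = y}) hy) k
  have hfreq : ∃ᶠ p in nhds (φ x), fderiv ℝ h p = (q : ℝ) • ContinuousLinearMap.id ℝ E := by
    rw [Filter.frequently_iff]
    intro U hU
    have hmem : φ ⁻¹' U ∩ φ.source ∈ nhds x :=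
      Filter.inter_mem ((continuousAt_extChartAt x) hU) (extChartAt_source_mem_nhds x)
    obtain ⟨y, ⟨hyU, hys⟩, hy⟩ := mem_closure_iff_nhds.1 hx _ hmem
    refine ⟨φ y, hyU, ?_⟩
    have hty : φ.target ∈ nhds (φ y) := extChartAt_target_mem_nhds' (φ.map_source hys)
    have hcont : ContinuousAt φ.symm (φ y) :=
      (continuousOn_extChartAt_symm x).continuousAt hty
    have hint : φ.symm ⁻¹' interior {y | f y = y} ∈ nhds (φ y) := by
      apply hcont
      rw [φ.left_inv hys]
      exact isOpen_interior.mem_nhds hy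
    have heq : h =ᶠ[nhds (φ y)] fun p => (q : ℝ) • p := by
      filter_upwards [hty, hint] with p hp hp'
      simp only [h, ψ, Function.comp]
      rw [Finset.sum_congr rfl fun k _ => by rw [hfix _ hp' k, φ.right_inv hp]]
      simp [Nat.cast_smul_eq_nsmul]
    rw [heq.fderiv_eq]
    exact ((hasFDerivAt_id (φ y)).const_smul (q : ℝ)).fderiv
  have hcontd : ContinuousAt (fderiv ℝ h) (φ x) :=
    (hh.fderiv_right (m := 0) (by simp)).continuousAt
  have hd : fderiv ℝ h (φ x) = (q : ℝ) • ContinuousLinearMap.id ℝ E := by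
    by_contra hne
    exact hfreq (hcontd.eventually_ne hne)
  have hq' : (q : ℝ) ≠ 0 := Nat.cast_ne_zero.2 hq
  let e : E ≃L[ℝ] E := ContinuousLinearEquiv.smulLeft (Units.mk0 (q : ℝ) hq')
  have hstrict : HasStrictFDerivAt h (e : E →L[ℝ] E) (φ x) := by
    have := hh.hasStrictFDerivAt (by simp)
    rw [hd] at this
    exact this
  have hinj := (hstrict.toOpenPartialHomeomorph h).injOn
  have hsrc := (hstrict.toOpenPartialHomeomorph h).open_source.mem_nhds
    hstrict.mem_toOpenPartialHomeomorph_source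
  have hA : φ ⁻¹' (hstrict.toOpenPartialHomeomorph h).source ∩ φ.source ∈ nhds x :=
    Filter.inter_mem ((continuousAt_extChartAt x) hsrc) (extChartAt_source_mem_nhds x)
  have hB := hf.continuous.continuousAt (x := x)
  have hB' : f ⁻¹' (φ ⁻¹' (hstrict.toOpenPartialHomeomorph h).source ∩ φ.source) ∈ nhds x := by
    apply hB
    rw [hfx]
    exact hA
  filter_upwards [hA, hB'] with y hy hy'
  refine φ.injOn hy'.2 hy.2 (hinj hy'.1 hy.1 ?_)
  simp only [HasStrictFDerivAt.toOpenPartialHomeomorph_coe, h, Function.comp]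
  rw [φ.left_inv hy.2, φ.left_inv hy'.2, hψf]

/-- A smooth map of finite order of a connected manifold which is the identity on a nonempty open
set is the identity. -/
theorem eq_self_of_finite_order {E : Type*} [NormedAddCommGroup E] [NormedSpace ℝ E]
    [FiniteDimensional ℝ E] {M : Type*} [TopologicalSpace M] [T2Space M] [PreconnectedSpace M]
    [ChartedSpace E M] [IsManifold 𝓘(ℝ, E) ∞ M] {f : M → M}
    (hf : ContMDiff 𝓘(ℝ, E) 𝓘(ℝ, E) ∞ f) {q : ℕ} (hq : q ≠ 0) (hfq : ∀ x, f^[q] x = x)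
    (hne : (interior {y | f y = y}).Nonempty) (x : M) : f x = x := by
  have hcl : IsClosed (interior {y | f y = y}) := isClosed_of_closure_subset fun y hy =>
    mem_interior_iff_mem_nhds.2 (eventually_fixed_of_mem_closure hf hq hfq hy)
  have huniv := IsClopen.eq_univ ⟨hcl, isOpen_interior⟩ hne
  exact interior_subset (s := {y | f y = y}) (huniv.symm ▸ mem_univ x : x ∈ interior {y | f y = y})

/-! ### The exponential map of the torus. -/

theorem torusExp_add {m : ℕ} (s t : TorusLie m) : torusExp (s + t) = torusExp s * torusExp t := by
  ext j; simp [torusExp, Circle.exp_add]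

theorem torusExp_zero {m : ℕ} : torusExp (0 : TorusLie m) = 1 := by
  ext j; simp [torusExp]

theorem torusExp_surjective {m : ℕ} : Function.Surjective (torusExp (m := m)) := fun g => by
  choose s hs using fun j => Circle.exp_surjective (g j)
  exact ⟨s, funext hs⟩

theorem torusExp_nsmul {m : ℕ} (k : ℕ) (s : TorusLie m) : torusExp (k • s) = torusExp s ^ k := by
  induction k with
  | zero => simp [torusExp_zero]
  | succ k ih => rw [succ_nsmul, torusExp_add, ih, pow_succ]

theorem torusExp_two_pi_int {m : ℕ} (n : Fin m → ℤ) :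
    torusExp ((2 * Real.pi) • fun i => (n i : ℝ)) = 1 := by
  funext j
  simp only [torusExp, Pi.smul_apply, smul_eq_mul, Pi.one_apply]
  rw [mul_comm]
  exact Circle.exp_int_mul_two_pi _

/-- A nonzero integer vector has a rational multiple whose exponential is nontrivial. -/
theorem exists_torusExp_ne_one {m : ℕ} {n : Fin m → ℤ} (hn : n ≠ 0) :
    ∃ q : ℕ, q ≠ 0 ∧ torusExp ((2 * Real.pi / q) • fun i => (n i : ℝ)) ≠ 1 := by
  obtain ⟨j, hj⟩ := Function.ne_iff.1 hn
  -- The number `|n_j| + 1` cannot divide the nonzero integer `n_j`.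
  refine ⟨(n j).natAbs + 1, Nat.succ_ne_zero _, fun h => ?_⟩
  have h1 := congrFun h j
  simp only [torusExp, Pi.smul_apply, smul_eq_mul, Pi.one_apply] at h1
  obtain ⟨k, hk⟩ := Circle.exp_eq_one.1 h1
  have hq : (((n j).natAbs + 1 : ℕ) : ℝ) ≠ 0 := Nat.cast_ne_zero.2 (Nat.succ_ne_zero _)
  have h2 : (n j : ℝ) = k * (((n j).natAbs + 1 : ℕ) : ℝ) := by
    have := Real.pi_ne_zero
    field_simp at hk
    linarith
  have h3 : n j = k * (((n j).natAbs + 1 : ℕ) : ℤ) := by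
    rw [← Int.cast_natCast (R := ℝ), ← Int.cast_mul] at h2
    exact Int.cast_injective h2
  have h4 : (((n j).natAbs + 1 : ℕ) : ℤ) ∣ n j := ⟨k, h3.trans (mul_comm _ _)⟩
  have h5 := Int.natAbs_dvd_natAbs.2 h4
  have h6 := Nat.le_of_dvd (Int.natAbs_pos.2 hj) h5
  simp only [Int.natAbs_natCast] at h6
  omega

/-! ### Points with discrete stabilizer: density and openness of the moment map. -/

namespace SymplecticToric

variable {m : ℕ} {M : Type*} [TopologicalSpace M] [ChartedSpace (EuclideanSpace ℝ (Fin (2 * m))) M]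
  [IsManifold (𝓡 (2 * m)) ∞ M] [MulAction (Torus m) M] (S : SymplecticToric m M)

include S in
theorem contMDiff_smul (g : Torus m) :
    ContMDiff (𝓡 (2 * m)) (𝓡 (2 * m)) ∞ (fun y : M => g • y) := by
  obtain ⟨s, rfl⟩ := torusExp_surjective g
  exact S.action_smooth.comp (contMDiff_const.prodMk contMDiff_id)

include S in
theorem contMDiff_orbit (x : M) :
    ContMDiff 𝓘(ℝ, TorusLie m) (𝓡 (2 * m)) ∞ (fun s : TorusLie m => torusExp s • x) :=
  S.action_smooth.comp (contMDiff_id.prodMk contMDiff_const)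

include S in
theorem contMDiff_curve (ξ : TorusLie m) (x : M) :
    ContMDiff 𝓘(ℝ, ℝ) (𝓡 (2 * m)) ∞ (fun s : ℝ => torusExp (s • ξ) • x) :=
  (S.contMDiff_orbit x).comp
    (contMDiff_iff_contDiff.2 (contDiff_id.smul contDiff_const))

include S in
/-- The orbit of a point under a one-parameter subgroup whose velocity vanishes is trivial. -/
theorem torusExp_smul_eq_self [T2Space M] {ξ : TorusLie m} {x : M}
    (h : fundamentalField ξ x = 0) (s : ℝ) : torusExp (s • ξ) • x = x := by
  let γ : ℝ → M := fun s => torusExp (s • ξ) • x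
  have hd : ∀ s, MDifferentiableAt 𝓘(ℝ, ℝ) (𝓡 (2 * m)) γ s := fun s =>
    (S.contMDiff_curve ξ x s).mdifferentiableAt (by simp)
  have h0 : mfderiv 𝓘(ℝ, ℝ) (𝓡 (2 * m)) γ 0 = 0 := by
    refine ContinuousLinearMap.ext_ring ?_
    exact h
  -- Since `γ u = exp(s ξ) • γ (u - s)`, the velocity at time `s` is the image of the velocity at
  -- `0`, hence zero. Uniqueness of integral curves of the zero field then makes `γ` constant.
  have hγ : ∀ s, HasMFDerivAt 𝓘(ℝ, ℝ) (𝓡 (2 * m)) γ s 0 := fun s => by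
    have h1 : HasMFDerivAt 𝓘(ℝ, ℝ) (𝓡 (2 * m)) γ (s - s) 0 := by
      rw [sub_self, ← h0]
      exact (hd 0).hasMFDerivAt
    have h2 : HasMFDerivAt 𝓘(ℝ, ℝ) 𝓘(ℝ, ℝ) (fun u : ℝ => u - s) s
        (ContinuousLinearMap.id ℝ ℝ) := by
      exact ((hasFDerivAt_id s).sub_const s).hasMFDerivAt
    have h3 := (((S.contMDiff_smul (torusExp (s • ξ))) (γ (s - s))).mdifferentiableAt
      (by simp)).hasMFDerivAt
    have h4 := h3.comp s (HasMFDerivAt.comp (f := fun u : ℝ => u - s) s h1 h2)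
    have h5 : (fun y : M => torusExp (s • ξ) • y) ∘ (γ ∘ fun u => u - s) = γ := by
      funext u
      simp only [Function.comp, γ]
      rw [← mul_smul, ← torusExp_add, ← add_smul, add_sub_cancel]
    rw [h5] at h4
    exact h4.congr_mfderiv (ContinuousLinearMap.ext fun u =>
      map_zero (mfderiv (𝓡 (2 * m)) (𝓡 (2 * m)) (fun y : M => torusExp (s • ξ) • y) (γ (s - s))))
  let v : ∀ y : M, TangentSpace (𝓡 (2 * m)) y := fun _ => 0
  have hv : ContMDiff (𝓡 (2 * m)) (𝓡 (2 * m)).tangent 1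
      (fun y => (⟨y, v y⟩ : TangentBundle (𝓡 (2 * m)) M)) :=
    contMDiff_zeroSection ℝ (TangentSpace (𝓡 (2 * m)) : M → Type _)
  have hz : ContinuousLinearMap.smulRight (1 : ℝ →L[ℝ] ℝ) (0 : EuclideanSpace ℝ (Fin (2 * m))) = 0 :=
    ContinuousLinearMap.smulRight_zero _
  have e1 : IsMIntegralCurve γ v := fun s => (hγ s).congr_mfderiv hz.symm
  have e2 : IsMIntegralCurve (fun _ => x) v := fun s =>
    (hasMFDerivAt_const x s).congr_mfderiv hz.symm
  have := isMIntegralCurve_Ioo_eq_of_contMDiff_boundaryless (t₀ := 0) hv e1 e2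
    (by simp [γ, torusExp_zero])
  exact congrFun this s

include S in
/-- The points with a discrete stabilizer are dense. -/
theorem dense_locallyFree [T2Space M] [CompactSpace M] [PreconnectedSpace M] :
    Dense {x : M | ∀ ξ : TorusLie m, fundamentalField ξ x = 0 → ξ = 0} := by
  have hq : ∀ n : {n : Fin m → ℤ // n ≠ 0}, ∃ q : ℕ, q ≠ 0 ∧
      torusExp ((2 * Real.pi / q) • fun i => (n.1 i : ℝ)) ≠ 1 :=
    fun n => exists_torusExp_ne_one n.2
  choose q hq0 hq1 using hq
  -- One nontrivial torsion element is chosen on each circle direction, so that only countably many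
  -- fixed sets occur.
  let g : {n : Fin m → ℤ // n ≠ 0} → Torus m :=
    fun n => torusExp ((2 * Real.pi / q n) • fun i => (n.1 i : ℝ))
  have hgq : ∀ n, g n ^ q n = 1 := fun n => by
    have : (q n : ℝ) ≠ 0 := Nat.cast_ne_zero.2 (hq0 n)
    simp only [g]
    rw [← torusExp_nsmul, ← Nat.cast_smul_eq_nsmul ℝ, smul_smul, mul_div_cancel₀ _ this,
      torusExp_two_pi_int]
  have hiter : ∀ n k (x : M), (fun y : M => g n • y)^[k] x = g n ^ k • x := fun n k x => by
    rw [smul_iterate]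
  have hdense : ∀ n, Dense {x : M | g n • x = x}ᶜ := fun n => by
    rw [← interior_eq_empty_iff_dense_compl]
    by_contra hne
    refine hq1 n (S.action_effective _ fun x => ?_)
    exact eq_self_of_finite_order (S.contMDiff_smul (g n)) (hq0 n)
      (fun x => by rw [hiter, hgq, one_smul]) (nonempty_iff_ne_empty.2 hne) x
  have hopen : ∀ n, IsOpen {x : M | g n • x = x}ᶜ := fun n =>
    (isClosed_eq (S.contMDiff_smul (g n)).continuous continuous_id).isOpen_compl
  refine (dense_iInter_of_isOpen hopen hdense).mono fun x hx ξ hξ => ?_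
  by_contra hξ0
  -- The preimage of the stabilizer in `𝔱`, rescaled by `2π` so that it contains `ℤ^m`. It contains
  -- the line through `ξ`, hence an integer line, which passes through the chosen torsion element at
  -- parameter `1 / q`.
  let L : AddSubgroup (Fin m → ℝ) :=
    { carrier := {s | torusExp ((2 * Real.pi) • s) • x = x}
      add_mem' := fun {a b} ha hb => by
        simp only [mem_ofPred_eq] at ha hb ⊢
        rw [smul_add, torusExp_add, mul_smul, hb, ha]
      zero_mem' := by simp [torusExp_zero]
      neg_mem' := fun {a} ha => by
        simp only [mem_ofPred_eq] at ha ⊢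
        nth_rw 1 [← ha]
        rw [← mul_smul, ← torusExp_add, smul_neg, neg_add_cancel, torusExp_zero, one_smul] }
  have hL : IsClosed (L : Set (Fin m → ℝ)) := by
    refine isClosed_eq ?_ continuous_const
    exact (S.contMDiff_orbit x).continuous.comp (continuous_const_smul _)
  obtain ⟨n, hn, hnL⟩ := exists_int_line_of_isClosed L hL
    (fun n => by
      change torusExp _ • x = x
      rw [torusExp_two_pi_int, one_smul]) hξ0
    (fun t => by
      change torusExp _ • x = x
      rw [smul_smul]
      exact S.torusExp_smul_eq_self hξ _)
  have h1 := mem_iInter.1 hx ⟨n, hn⟩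
  apply h1
  have h2 : torusExp ((2 * Real.pi) • ((q ⟨n, hn⟩ : ℝ)⁻¹ • fun i => (n i : ℝ))) • x = x := hnL _
  rw [smul_smul, ← div_eq_mul_inv] at h2
  exact h2

theorem mvfderiv_μ_apply (ξ : TorusLie m) (x : M) (v : TangentSpace (𝓡 (2 * m)) x) :
    mvfderiv (𝓡 (2 * m)) (fun y => S.μ y ξ) x v = mvfderiv (𝓡 (2 * m)) S.μ x v ξ := by
  have h1 := ((S.μ_smooth x).mdifferentiableAt (by simp)).hasMFDerivAt
  have h2 : HasMFDerivAt 𝓘(ℝ, TorusLieDual m) 𝓘(ℝ, ℝ)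
      (ContinuousLinearMap.apply ℝ ℝ ξ) (S.μ x) (ContinuousLinearMap.apply ℝ ℝ ξ) :=
    (ContinuousLinearMap.apply ℝ ℝ ξ).hasMFDerivAt
  have h3 : mfderiv (𝓡 (2 * m)) 𝓘(ℝ, ℝ) (fun y => S.μ y ξ) x = _ := (h2.comp x h1).mfderiv
  simp only [mvfderiv]
  rw [h3]
  rfl

theorem Ω_fundamentalField (ξ : TorusLie m) (x : M) (v : TangentSpace (𝓡 (2 * m)) x) :
    S.Ω x (fundamentalField ξ x) v = - mvfderiv (𝓡 (2 * m)) S.μ x v ξ := by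
  rw [S.μ_hamiltonian, mvfderiv_μ_apply]

/-- The moment map is open at the points with a discrete stabilizer. -/
theorem mem_regular_of_locallyFree {x : M}
    (hx : ∀ ξ : TorusLie m, fundamentalField ξ x = 0 → ξ = 0) : x ∈ S.regular := by
  let d : EuclideanSpace ℝ (Fin (2 * m)) →L[ℝ] TorusLieDual m := mvfderiv (𝓡 (2 * m)) S.μ x
  -- A functional killing the image of `dμ` is evaluation at some `ξ ∈ 𝔱`. Then `Ω(ξ♯, ·) = -dμ^ξ =
  -- 0`, so `ξ♯ = 0` and `ξ = 0`.
  have hsurj : LinearMap.range d.toLinearMap = ⊤ := by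
    by_contra hne
    obtain ⟨f, hf0, hf⟩ := Submodule.exists_le_ker_of_lt_top _ (lt_top_iff_ne_top.2 hne)
    let c : Module.Dual ℝ (TorusLie m) ≃ₗ[ℝ] TorusLieDual m := LinearMap.toContinuousLinearMap
    obtain ⟨ξ, hξ⟩ := (Module.evalEquiv ℝ (TorusLie m)).surjective (f ∘ₗ c.toLinearMap)
    have hξ' : ∀ α : TorusLieDual m, f α = α ξ := fun α => by
      have := LinearMap.congr_fun hξ (c.symm α)
      simp only [Module.evalEquiv_apply, LinearMap.comp_apply, LinearEquiv.coe_coe,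
        LinearEquiv.apply_symm_apply] at this
      rw [← this]
      rfl
    have h0 : ξ = 0 := by
      refine hx ξ (S.Ω_nondegenerate x _ fun v => ?_)
      rw [S.Ω_fundamentalField]
      have h1 : f (d v) = 0 := hf ⟨v, rfl⟩
      rw [hξ'] at h1
      exact neg_eq_zero.2 h1
    apply hf0
    ext α
    rw [hξ', h0]
    simp
  have hF : ContDiffAt ℝ ∞ (S.μ ∘ (extChartAt (𝓡 (2 * m)) x).symm) (extChartAt (𝓡 (2 * m)) x x) := by
    rw [← contMDiffAt_iff_contDiffAt]
    exact S.μ_smooth.contMDiffAt.comp _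
      ((contMDiffOn_extChartAt_symm x).contMDiffAt (extChartAt_target_mem_nhds x))
  have hd : fderiv ℝ (S.μ ∘ (extChartAt (𝓡 (2 * m)) x).symm) (extChartAt (𝓡 (2 * m)) x x) = d := by
    have h1 := ((S.μ_smooth x).mdifferentiableAt (by simp)).mfderiv
    simp only [writtenInExtChartAt, extChartAt_model_space_eq_id, modelWithCornersSelf_coe,
      range_id, fderivWithin_univ, PartialEquiv.refl_coe, Function.id_comp] at h1
    simp only [d, mvfderiv]
    rw [h1]
    rfl
  have hs := hF.hasStrictFDerivAt (by simp)
  rw [hd] at hs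
  have hmap := hs.map_nhds_eq_of_surj hsurj
  have hx' : (S.μ ∘ (extChartAt (𝓡 (2 * m)) x).symm) (extChartAt (𝓡 (2 * m)) x x) = S.μ x := by
    simp
  rw [hx'] at hmap
  change S.μ x ∈ interior (range S.μ)
  rw [mem_interior_iff_mem_nhds, ← hmap]
  exact Filter.mem_map.2 (Filter.Eventually.of_forall fun y => ⟨_, rfl⟩)

end SymplecticToric

/-! ### Inverting nondegenerate forms. -/

section LinearAlgebra

variable {V : Type*} [AddCommGroup V] [Module ℝ V] [TopologicalSpace V]
  [IsTopologicalAddGroup V] [ContinuousSMul ℝ V] [T2Space V] [FiniteDimensional ℝ V]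

/-- A nondegenerate bilinear form on a finite-dimensional space is invertible. -/
theorem isInvertible_of_nondegenerate {Ω : V →L[ℝ] V →L[ℝ] ℝ}
    (h : ∀ v, (∀ w, Ω v w = 0) → v = 0) : Ω.IsInvertible := by
  let c : (V →ₗ[ℝ] ℝ) ≃ₗ[ℝ] (V →L[ℝ] ℝ) := LinearMap.toContinuousLinearMap
  let f : V →ₗ[ℝ] (V →ₗ[ℝ] ℝ) := c.symm.toLinearMap ∘ₗ Ω.toLinearMap
  have hf : Function.Injective f := by
    rw [← LinearMap.ker_eq_bot, LinearMap.ker_eq_bot']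
    intro v hv
    exact h v fun w => LinearMap.congr_fun hv w
  have hbij : Function.Bijective Ω := by
    have h1 : Function.Bijective f :=
      ⟨hf, (LinearMap.injective_iff_surjective_of_finrank_eq_finrank
        (Subspace.dual_finrank_eq (K := ℝ) (V := V)).symm).1 hf⟩
    have h2 : (Ω : V → V →L[ℝ] ℝ) = c ∘ f := by
      funext v
      simp [f]
    rw [h2]
    exact c.bijective.comp h1
  have : FiniteDimensional ℝ (V →L[ℝ] ℝ) := c.finiteDimensional
  exact ⟨(LinearEquiv.ofBijective Ω.toLinearMap hbij).toContinuousLinearEquiv, by ext; rfl⟩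

theorem inverse_apply_of_nondegenerate {Ω : V →L[ℝ] V →L[ℝ] ℝ}
    (h : ∀ v, (∀ w, Ω v w = 0) → v = 0) (α : V →L[ℝ] ℝ) : Ω (Ω.inverse α) = α := by
  obtain ⟨e, he⟩ := isInvertible_of_nondegenerate h
  rw [← he, ContinuousLinearMap.inverse_equiv]
  simp

/-- `ContinuousLinearMap.inverse` is zero on noninvertible maps; nondegeneracy makes it a genuine
inverse here. -/
theorem symplecticAdjoint_apply {Ω : V →L[ℝ] V →L[ℝ] ℝ}
    (h : ∀ v, (∀ w, Ω v w = 0) → v = 0) (A : V →L[ℝ] V) (v w : V) :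
    Ω (symplecticAdjoint Ω A v) w = Ω v (A w) := by
  simp only [symplecticAdjoint, ContinuousLinearMap.comp_apply]
  rw [inverse_apply_of_nondegenerate h]
  rfl

end LinearAlgebra

/-! ### Tensor fields in trivializations of the tangent bundle. -/

section Coordinates

variable {m : ℕ} {M : Type*} [TopologicalSpace M] [ChartedSpace (EuclideanSpace ℝ (Fin (2 * m))) M]
  [IsManifold (𝓡 (2 * m)) ∞ M]

/-- The tangent space at `x` in the trivialization of the tangent bundle at `x₀`. -/
noncomputable def toCoord (x₀ x : M) :
    TangentSpace (𝓡 (2 * m)) x →L[ℝ] EuclideanSpace ℝ (Fin (2 * m)) :=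
  (trivializationAt (EuclideanSpace ℝ (Fin (2 * m)))
    (TangentSpace (𝓡 (2 * m)) : M → Type _) x₀).continuousLinearMapAt ℝ x

/-- The inverse of `toCoord`. -/
noncomputable def ofCoord (x₀ x : M) :
    EuclideanSpace ℝ (Fin (2 * m)) →L[ℝ] TangentSpace (𝓡 (2 * m)) x :=
  (trivializationAt (EuclideanSpace ℝ (Fin (2 * m)))
    (TangentSpace (𝓡 (2 * m)) : M → Type _) x₀).symmL ℝ x

/-- The domain of the trivialization of the tangent bundle at `x₀`. -/
def coordDomain (x₀ : M) : Set M :=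
  (trivializationAt (EuclideanSpace ℝ (Fin (2 * m)))
    (TangentSpace (𝓡 (2 * m)) : M → Type _) x₀).baseSet

theorem coordDomain_eventually (x₀ : M) :
    ∀ᶠ x in nhds x₀, x ∈ coordDomain (m := m) x₀ :=
  (trivializationAt (EuclideanSpace ℝ (Fin (2 * m)))
    (TangentSpace (𝓡 (2 * m)) : M → Type _) x₀).open_baseSet.mem_nhds
    (FiberBundle.mem_baseSet_trivializationAt' x₀)

theorem mem_coordDomain (x₀ : M) : x₀ ∈ coordDomain (m := m) x₀ :=
  FiberBundle.mem_baseSet_trivializationAt' x₀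

theorem ofCoord_toCoord {x₀ x : M} (hx : x ∈ coordDomain (m := m) x₀)
    (v : TangentSpace (𝓡 (2 * m)) x) : ofCoord x₀ x (toCoord x₀ x v) = v :=
  Trivialization.symmL_continuousLinearMapAt _ hx v

theorem toCoord_ofCoord {x₀ x : M} (hx : x ∈ coordDomain (m := m) x₀)
    (v : EuclideanSpace ℝ (Fin (2 * m))) : toCoord x₀ x (ofCoord x₀ x v) = v :=
  Trivialization.continuousLinearMapAt_symmL _ hx v

/-- The expression of a field of endomorphisms in the trivialization at `x₀`. -/
noncomputable def EndField.coord (J : EndField m M) (x₀ x : M) :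
    EuclideanSpace ℝ (Fin (2 * m)) →L[ℝ] EuclideanSpace ℝ (Fin (2 * m)) :=
  toCoord x₀ x ∘L J x ∘L ofCoord x₀ x

/-- The expression of a covariant 2-tensor in the trivialization at `x₀`. -/
noncomputable def BilinField.coord (b : BilinField m M) (x₀ x : M) :
    EuclideanSpace ℝ (Fin (2 * m)) →L[ℝ] EuclideanSpace ℝ (Fin (2 * m)) →L[ℝ] ℝ :=
  ContinuousLinearMap.precomp ℝ (ofCoord x₀ x) ∘L b x ∘L ofCoord x₀ x

theorem EndField.smoothAt_iff (J : EndField m M) (x₀ : M) :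
    ContMDiffAt (𝓡 (2 * m)) ((𝓡 (2 * m)).prod
      𝓘(ℝ, EuclideanSpace ℝ (Fin (2 * m)) →L[ℝ] EuclideanSpace ℝ (Fin (2 * m)))) ∞
    (fun x => TotalSpace.mk'
      (EuclideanSpace ℝ (Fin (2 * m)) →L[ℝ] EuclideanSpace ℝ (Fin (2 * m)))
      (E := fun x : M =>
        TangentSpace (𝓡 (2 * m)) x →L[ℝ] TangentSpace (𝓡 (2 * m)) x) x (J x)) x₀ ↔
    ContMDiffAt (𝓡 (2 * m))
      𝓘(ℝ, EuclideanSpace ℝ (Fin (2 * m)) →L[ℝ] EuclideanSpace ℝ (Fin (2 * m))) ∞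
      (J.coord x₀) x₀ := by
  rw [contMDiffAt_hom_bundle]
  exact and_iff_right contMDiffAt_id

theorem EndField.smoothOn_iff (J : EndField m M) {U : Set M} (hU : IsOpen U) :
    J.SmoothOn U ↔ ∀ x₀ ∈ U, ContMDiffAt (𝓡 (2 * m))
      𝓘(ℝ, EuclideanSpace ℝ (Fin (2 * m)) →L[ℝ] EuclideanSpace ℝ (Fin (2 * m))) ∞
      (J.coord x₀) x₀ := by
  constructor
  · intro h x hx
    rw [← J.smoothAt_iff]
    exact ContMDiffOn.contMDiffAt h (hU.mem_nhds hx)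
  · intro h x hx
    exact ((J.smoothAt_iff x).2 (h x hx)).contMDiffWithinAt

theorem BilinField.coord_apply (b : BilinField m M) (x₀ x : M)
    (u v : EuclideanSpace ℝ (Fin (2 * m))) :
    b.coord x₀ x u v = b x (ofCoord x₀ x u) (ofCoord x₀ x v) := rfl

/-- The coordinates of the iterated hom bundle are compared with `coord` only over the domain of the
trivialization, which suffices for smoothness at `x₀`. -/
theorem BilinField.SmoothOn.contMDiffAt_coord {b : BilinField m M} (hb : b.SmoothOn univ) (x₀ : M) :
    ContMDiffAt (𝓡 (2 * m))
      𝓘(ℝ, EuclideanSpace ℝ (Fin (2 * m)) →L[ℝ] EuclideanSpace ℝ (Fin (2 * m)) →L[ℝ] ℝ) ∞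
      (b.coord x₀) x₀ := by
  have h := ContMDiffOn.contMDiffAt hb (x := x₀) Filter.univ_mem
  rw [contMDiffAt_hom_bundle] at h
  refine h.2.congr_of_eventuallyEq ?_
  filter_upwards [coordDomain_eventually (m := m) x₀] with x hx
  ext u v
  rw [BilinField.coord_apply]
  have h2 := inCoordinates_apply_eq₂ (𝕜 := ℝ) (F₁ := EuclideanSpace ℝ (Fin (2 * m)))
    (E₁ := (TangentSpace (𝓡 (2 * m)) : M → Type _)) (F₂ := EuclideanSpace ℝ (Fin (2 * m)))
    (E₂ := (TangentSpace (𝓡 (2 * m)) : M → Type _)) (E₃ := Bundle.Trivial M ℝ) (F₃ := ℝ)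
    (ϕ := b x) (v := u) (w := v) hx hx (mem_univ x)
  refine Eq.trans ?_ h2.symm
  change _ = Trivialization.linearMapAt ℝ (Bundle.Trivial.trivialization M ℝ) x _
  rw [Bundle.Trivial.linearMapAt_trivialization, LinearMap.id_apply]
  simp only [ofCoord]
  rw [Trivialization.symmL_apply _ hx, Trivialization.symmL_apply _ hx]

theorem contMDiffAt_mvfderiv_coord {f : M → ℝ} (hf : ContMDiff (𝓡 (2 * m)) 𝓘(ℝ, ℝ) ∞ f) (x₀ : M) :
    ContMDiffAt (𝓡 (2 * m)) 𝓘(ℝ, EuclideanSpace ℝ (Fin (2 * m)) →L[ℝ] ℝ) ∞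
      (fun x => mvfderiv (𝓡 (2 * m)) f x ∘L ofCoord x₀ x) x₀ := by
  have h := (hf x₀).mfderiv_const (m := ∞) (by simp)
  refine h.congr_of_eventuallyEq (Filter.Eventually.of_forall fun x => ?_)
  ext u
  simp only [inTangentCoordinates, ContinuousLinearMap.inCoordinates]
  simp [mvfderiv, ofCoord]
  rfl

/-- Two fields of endomorphisms, smooth at a point and equal arbitrarily near to it, are equal
there. -/
theorem EndField.eq_of_frequently_eq {J J' : EndField m M} {x₀ : M}
    (hJ : ContinuousAt (J.coord x₀) x₀) (hJ' : ContinuousAt (J'.coord x₀) x₀)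
    (h : ∃ᶠ x in nhds x₀, J x = J' x) : J x₀ = J' x₀ := by
  have h1 : ∀ u, J.coord x₀ x₀ u = J'.coord x₀ x₀ u := fun u => by
    by_contra hne
    refine h ?_
    have hc : ContinuousAt (fun x => J.coord x₀ x u - J'.coord x₀ x u) x₀ :=
      (hJ.clm_apply continuousAt_const).sub (hJ'.clm_apply continuousAt_const)
    filter_upwards [hc.eventually_ne (sub_ne_zero.2 hne)] with x hx hx'
    apply hx
    simp only [EndField.coord, hx', sub_self]
  ext1 v
  have h2 := congrArg (ofCoord x₀ x₀) (h1 (toCoord x₀ x₀ v))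
  simpa only [EndField.coord, ContinuousLinearMap.comp_apply,
    ofCoord_toCoord (mem_coordDomain x₀)] using h2

/-- Inversion of operators is smooth at invertible ones, and in finite dimension nondegenerate means
invertible. -/
theorem contMDiffAt_inverse_coord {b : BilinField m M} (hb : b.SmoothOn univ)
    (hnd : ∀ x v, (∀ w, b x v w = 0) → v = 0) (x₀ : M) :
    ContMDiffAt (𝓡 (2 * m))
      𝓘(ℝ, (EuclideanSpace ℝ (Fin (2 * m)) →L[ℝ] ℝ) →L[ℝ] EuclideanSpace ℝ (Fin (2 * m))) ∞
      (fun x => (b.coord x₀ x).inverse) x₀ := by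
  have h1 : (b.coord x₀ x₀).IsInvertible := by
    refine isInvertible_of_nondegenerate fun v hv => ?_
    have h2 : ofCoord x₀ x₀ v = 0 := hnd x₀ _ fun w => by
      rw [← ofCoord_toCoord (mem_coordDomain x₀) w]
      exact hv _
    rw [← toCoord_ofCoord (mem_coordDomain x₀) v, h2, map_zero]
  exact (h1.contDiffAt_map_inverse (n := ∞)).contMDiffAt.comp x₀ (hb.contMDiffAt_coord x₀)

/-- A field of endomorphisms characterized by a nondegenerate form, smooth in coordinates, and
a field of bilinear forms, smooth in coordinates, is smooth in coordinates. -/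
theorem EndField.contMDiffAt_coord_of_bilin {b c : BilinField m M} {J : EndField m M}
    (hb : b.SmoothOn univ) (hnd : ∀ x v, (∀ w, b x v w = 0) → v = 0) {x₀ : M}
    (hc : ContMDiffAt (𝓡 (2 * m))
      𝓘(ℝ, EuclideanSpace ℝ (Fin (2 * m)) →L[ℝ] EuclideanSpace ℝ (Fin (2 * m)) →L[ℝ] ℝ) ∞
      (c.coord x₀) x₀)
    (h : ∀ᶠ x in nhds x₀, ∀ v w, b x (J x v) w = c x v w) :
    ContMDiffAt (𝓡 (2 * m))
      𝓘(ℝ, EuclideanSpace ℝ (Fin (2 * m)) →L[ℝ] EuclideanSpace ℝ (Fin (2 * m))) ∞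
      (J.coord x₀) x₀ := by
  refine ((contMDiffAt_inverse_coord hb hnd x₀).clm_comp hc).congr_of_eventuallyEq ?_
  filter_upwards [h, coordDomain_eventually (m := m) x₀] with x hx hx'
  have hnd' : ∀ v, (∀ w, b.coord x₀ x v w = 0) → v = 0 := fun v hv => by
    have h2 : ofCoord x₀ x v = 0 := hnd x _ fun w => by
      rw [← ofCoord_toCoord hx' w]
      exact hv _
    rw [← toCoord_ofCoord hx' v, h2, map_zero]
  have hinj : Function.Injective (b.coord x₀ x) := by
    rw [injective_iff_map_eq_zero]
    exact fun v hv => hnd' v fun w => by rw [hv]; rfl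
  ext1 u
  apply hinj
  rw [ContinuousLinearMap.comp_apply, inverse_apply_of_nondegenerate hnd']
  ext w
  rw [BilinField.coord_apply, BilinField.coord_apply, ← hx]
  simp only [EndField.coord, ContinuousLinearMap.comp_apply, ofCoord_toCoord hx']

end Coordinates

/-! ### Dual frames and the matrix identity behind (C2). -/

section DualFrames

variable {V : Type*} [AddCommGroup V] [Module ℝ V] [TopologicalSpace V]

/-- The existence hypothesis rules out the default value `0`; the remaining work reconciles the
decidability instances. -/
theorem dualCovector_apply {ι : Type*} [DecidableEq ι] (e : ι → V) (i : ι)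
    (h : ∃ α : V →L[ℝ] ℝ, ∀ j, α (e j) = if j = i then 1 else 0) (j : ι) :
    dualCovector e i (e j) = if j = i then 1 else 0 := by
  classical
  have h' : ∃ α : V →L[ℝ] ℝ, ∀ j, α (e j) = @ite ℝ (j = i) (Classical.propDecidable _) 1 0 := by
    obtain ⟨α, hα⟩ := h
    exact ⟨α, fun j => by rw [hα j]; congr⟩
  rw [dualCovector, dif_pos h', h'.choose_spec j]
  congr

theorem apply_dualVector {ι : Type*} [DecidableEq ι] (θ : ι → V →L[ℝ] ℝ) (i : ι)
    (h : ∃ v : V, ∀ j, θ j v = if j = i then 1 else 0) (j : ι) :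
    θ j (dualVector θ i) = if j = i then 1 else 0 := by
  classical
  have h' : ∃ v : V, ∀ j, θ j v = @ite ℝ (j = i) (Classical.propDecidable _) 1 0 := by
    obtain ⟨α, hα⟩ := h
    exact ⟨α, fun j => by rw [hα j]; congr⟩
  rw [dualVector, dif_pos h', h'.choose_spec j]
  congr

end DualFrames

/-- Congruence by `P⁻¹` sends `Pᵀ R P - Pᵀ` to `R - P⁻¹`. With `P = Ψ` and `R = Ψreg⁻¹` this
explains the shape of (C2). -/
theorem dotProduct_congruence_sub {m : ℕ} {P R : Matrix (Fin m) (Fin m) ℝ} (hP : P⁻¹ * P = 1)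
    (q q' : Fin m → ℝ) :
    (P⁻¹ *ᵥ q) ⬝ᵥ ((Pᵀ * R * P - Pᵀ) *ᵥ (P⁻¹ *ᵥ q')) = q ⬝ᵥ (R *ᵥ q') - q ⬝ᵥ (P⁻¹ *ᵥ q') := by
  have h1 : P * P⁻¹ = 1 := mul_eq_one_comm.1 hP
  have h2 : (P⁻¹)ᵀ * Pᵀ = 1 := by rw [← Matrix.transpose_mul, h1, Matrix.transpose_one]
  have h3 : (P⁻¹)ᵀ * (Pᵀ * R * P - Pᵀ) * P⁻¹ = R - P⁻¹ := by
    rw [Matrix.mul_sub, Matrix.sub_mul, h2, Matrix.one_mul, Matrix.mul_assoc Pᵀ,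
      ← Matrix.mul_assoc _ Pᵀ, h2, Matrix.one_mul, Matrix.mul_assoc, h1, Matrix.mul_one]
  rw [← dotProduct_sub, ← Matrix.sub_mulVec, ← h3, ← Matrix.mulVec_mulVec, ← Matrix.mulVec_mulVec,
    Matrix.dotProduct_mulVec _ (P⁻¹)ᵀ, Matrix.vecMul_transpose]

/-! ### Darboux frames and antidiagonal structures. -/

namespace SymplecticToric

variable {m : ℕ} {M : Type*} [TopologicalSpace M] [ChartedSpace (EuclideanSpace ℝ (Fin (2 * m))) M]
  [IsManifold (𝓡 (2 * m)) ∞ M] [MulAction (Torus m) M] (S : SymplecticToric m M)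

theorem Ω_swap (x : M) (v w : TangentSpace (𝓡 (2 * m)) x) : S.Ω x v w = - S.Ω x w v := by
  have h := S.Ω_alternating x (v + w)
  simp only [map_add, add_apply, S.Ω_alternating] at h
  linarith

theorem Ω_injective (x : M) : Function.Injective (S.Ω x) := by
  rw [injective_iff_map_eq_zero]
  exact fun v hv => S.Ω_nondegenerate x v fun w => by rw [hv]; rfl

-- Linearity in the Lie algebra variable is read off from the Hamiltonian identity: `dμ^η` is
-- additive in `η` and `Ω` is injective.
include S in
theorem fundamentalField_add (η ζ : TorusLie m) (x : M) :
    fundamentalField (η + ζ) x = fundamentalField η x + fundamentalField ζ x := by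
  apply S.Ω_injective x
  ext v
  rw [map_add, add_apply, S.Ω_fundamentalField, S.Ω_fundamentalField,
    S.Ω_fundamentalField, map_add]
  ring

include S in
theorem fundamentalField_smul (c : ℝ) (η : TorusLie m) (x : M) :
    fundamentalField (c • η) x = c • fundamentalField η x := by
  apply S.Ω_injective x
  ext v
  rw [map_smul, smul_apply, S.Ω_fundamentalField, S.Ω_fundamentalField,
    map_smul, smul_neg]

/-- The infinitesimal action at a point, as a linear map. -/
noncomputable def infinitesimalAction (x : M) : TorusLie m →ₗ[ℝ] TangentSpace (𝓡 (2 * m)) x where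
  toFun η := fundamentalField η x
  map_add' η ζ := S.fundamentalField_add η ζ x
  map_smul' c η := S.fundamentalField_smul c η x

theorem mvfderiv_μ_fundamentalField (η ζ : TorusLie m) (x : M) :
    mvfderiv (𝓡 (2 * m)) (fun y => S.μ y η) x (fundamentalField ζ x) = 0 := by
  let γ : ℝ → M := fun s => torusExp (s • ζ) • x
  have h0 : γ 0 = x := by simp [γ, torusExp_zero]
  have h1 : HasMFDerivAt 𝓘(ℝ, ℝ) (𝓡 (2 * m)) γ 0 (mfderiv 𝓘(ℝ, ℝ) (𝓡 (2 * m)) γ 0) :=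
    ((S.contMDiff_curve ζ x 0).mdifferentiableAt (by simp)).hasMFDerivAt
  have hf : ContMDiff (𝓡 (2 * m)) 𝓘(ℝ, ℝ) ∞ (fun y => S.μ y η) :=
    (ContinuousLinearMap.apply ℝ ℝ η).contMDiff.comp S.μ_smooth
  have h2 : HasMFDerivAt (𝓡 (2 * m)) 𝓘(ℝ, ℝ) (fun y => S.μ y η) (γ 0)
      (mfderiv (𝓡 (2 * m)) 𝓘(ℝ, ℝ) (fun y => S.μ y η) (γ 0)) :=
    ((hf (γ 0)).mdifferentiableAt (by simp)).hasMFDerivAt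
  have h3 := (h2.comp (0 : ℝ) h1).mfderiv
  have h4 : (fun y => S.μ y η) ∘ γ = fun _ => S.μ x η := by
    funext s
    simp only [Function.comp, γ, S.μ_invariant]
  rw [h4, mfderiv_const, h0] at h3
  have h5 := congrArg (fun f : ℝ →L[ℝ] ℝ => f 1) h3
  exact h5.symm

theorem Ω_fundamentalField_fundamentalField (η ζ : TorusLie m) (x : M) :
    S.Ω x (fundamentalField η x) (fundamentalField ζ x) = 0 := by
  rw [S.μ_hamiltonian, S.mvfderiv_μ_fundamentalField, neg_zero]

theorem adjoint_apply (J : EndField m M) (x : M) (v w : TangentSpace (𝓡 (2 * m)) x) :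
    S.Ω x (S.adjoint J x v) w = S.Ω x v (J x w) := by
  have : FiniteDimensional ℝ (TangentSpace (𝓡 (2 * m)) x) :=
    inferInstanceAs (FiniteDimensional ℝ (EuclideanSpace ℝ (Fin (2 * m))))
  have : T2Space (TangentSpace (𝓡 (2 * m)) x) :=
    inferInstanceAs (T2Space (EuclideanSpace ℝ (Fin (2 * m))))
  exact symplecticAdjoint_apply (S.Ω_nondegenerate x) _ v w

/-- `J 𝒦` is isotropic if `J` is aligned with its adjoint. -/
theorem Ω_map_fundamentalField {J : EndField m M} {x : M}
    (hsq : ∀ v, J x (J x v) = -v)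
    (hal : (S.orbitDistribution x).map (S.adjoint J x).toLinearMap
      = (S.orbitDistribution x).map (J x).toLinearMap) (η ζ : TorusLie m) :
    S.Ω x (J x (fundamentalField η x)) (J x (fundamentalField ζ x)) = 0 := by
  have h1 : J x (fundamentalField η x) ∈
      (S.orbitDistribution x).map (J x).toLinearMap :=
    Submodule.mem_map_of_mem (Submodule.subset_span ⟨η, rfl⟩)
  rw [← hal] at h1
  obtain ⟨κ, hκ, hκ'⟩ := h1
  obtain ⟨θ, rfl⟩ : ∃ θ, fundamentalField θ x = κ := by
    have : S.orbitDistribution x = LinearMap.range (S.infinitesimalAction x) := by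
      rw [orbitDistribution, ← Submodule.span_eq (LinearMap.range (S.infinitesimalAction x))]
      rfl
    rw [this] at hκ
    exact hκ
  have h2 : S.adjoint J x (fundamentalField θ x) = J x (fundamentalField η x) := hκ'
  -- Writing `J η♯ = J^{*Ω} θ♯` moves the adjoint across: `Ω(J^{*Ω} θ♯, J ζ♯) = Ω(θ♯, J² ζ♯) =
  -- -Ω(θ♯, ζ♯) = 0`.
  rw [← h2, S.adjoint_apply, hsq, map_neg, S.Ω_fundamentalField_fundamentalField, neg_zero]

variable (ξ : Module.Basis (Fin m) ℝ (TorusLie m))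

/-- At a point with discrete stabilizer, the vectors `(-J₀ K_j, K_j)` form a frame. -/
theorem linearIndependent_frame {J₀ : EndField m M} {x : M}
    (hx : ∀ η : TorusLie m, fundamentalField η x = 0 → η = 0)
    (htame : ∀ v, v ≠ 0 → 0 < S.Ω x v (J₀ x v)) :
    LinearIndependent ℝ (Sum.elim (fun j : Fin m => -(J₀ x (fundamentalField (ξ j) x)))
      (fun j : Fin m => fundamentalField (ξ j) x)) := by
  have hinj : LinearMap.ker (S.infinitesimalAction x) = ⊥ := by
    rw [LinearMap.ker_eq_bot']
    exact hx
  have hK : LinearIndependent ℝ (fun j : Fin m => S.infinitesimalAction x (ξ j)) :=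
    ξ.linearIndependent.map' _ hinj
  rw [Fintype.linearIndependent_iff] at hK ⊢
  intro c hc
  rw [Fintype.sum_sum_type] at hc
  simp only [Sum.elim_inl, Sum.elim_inr, smul_neg, Finset.sum_neg_distrib] at hc
  have e1 : ∑ j, c (Sum.inl j) • J₀ x (fundamentalField (ξ j) x)
      = J₀ x (S.infinitesimalAction x (∑ j, c (Sum.inl j) • ξ j)) := by
    simp only [map_sum, map_smul]
    rfl
  have e2 : ∑ j, c (Sum.inr j) • fundamentalField (ξ j) x
      = S.infinitesimalAction x (∑ j, c (Sum.inr j) • ξ j) := by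
    simp only [map_sum, map_smul]
    rfl
  rw [e1, e2, neg_add_eq_zero] at hc
  -- The relation reads `J₀ κ = κ'` with `κ, κ'` tangent to the orbit. Orbits are isotropic, so
  -- `Ω(κ, J₀ κ) = 0` and taming gives `κ = 0`.
  have h0 : S.infinitesimalAction x (∑ j, c (Sum.inl j) • ξ j) = 0 := by
    by_contra hne
    have h1 := htame _ hne
    rw [hc] at h1
    exact h1.ne' (S.Ω_fundamentalField_fundamentalField _ _ x)
  rw [h0, map_zero] at hc
  simp only [map_sum, map_smul] at h0 hc
  rintro (j | j)
  · exact hK _ h0 j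
  · exact hK _ hc.symm j

/-- The relations between the frame `(∂/∂μ^i, K_i)`, its dual coframe and the symplectic form, at a
point of the tangent space. -/
structure IsDarbouxFrame (J₀ : EndField m M) (x : M) : Prop where
  dmu_K : ∀ i j, S.dmu ξ i x (fundamentalField (ξ j) x) = 0
  dt_K : ∀ i j, S.dt ξ J₀ i x (fundamentalField (ξ j) x) = if j = i then 1 else 0
  dmu_partialMu : ∀ i j, S.dmu ξ i x (S.partialMu ξ J₀ j x) = if i = j then 1 else 0
  dt_partialMu : ∀ i j, S.dt ξ J₀ i x (S.partialMu ξ J₀ j x) = 0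
  Ω_eq : ∀ v w, S.Ω x v w = (fun i => S.dmu ξ i x v) ⬝ᵥ (fun i => S.dt ξ J₀ i x w)
    - (fun i => S.dt ξ J₀ i x v) ⬝ᵥ (fun i => S.dmu ξ i x w)

/-- The frame splits the tangent space into `𝒦`, isotropic because `μ` is invariant, and `J₀ 𝒦`,
isotropic because `J₀` is aligned with its adjoint. The pairing between the two is given by the
Hamiltonian identity. Integrability of `J₀` plays no role. -/
theorem isDarbouxFrame {J₀ : EndField m M} (hJ₀ : S.IsDGAK univ J₀) {x : M}
    (hx : ∀ η : TorusLie m, fundamentalField η x = 0 → η = 0) : S.IsDarbouxFrame ξ J₀ x := by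
  have : FiniteDimensional ℝ (TangentSpace (𝓡 (2 * m)) x) :=
    inferInstanceAs (FiniteDimensional ℝ (EuclideanSpace ℝ (Fin (2 * m))))
  have : T2Space (TangentSpace (𝓡 (2 * m)) x) :=
    inferInstanceAs (T2Space (EuclideanSpace ℝ (Fin (2 * m))))
  have hrank : Module.finrank ℝ (TangentSpace (𝓡 (2 * m)) x) = 2 * m :=
    finrank_euclideanSpace_fin (𝕜 := ℝ) (n := 2 * m)
  have htame := hJ₀.1.tamed x (mem_univ x)
  have hli := S.linearIndependent_frame ξ hx htame
  have hcard : Fintype.card (Fin m ⊕ Fin m) = Module.finrank ℝ (TangentSpace (𝓡 (2 * m)) x) := by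
    rw [hrank, Fintype.card_sum, Fintype.card_fin, two_mul]
  let b := basisOfLinearIndependentOfCardEqFinrank' _ hli hcard
  have hb : ⇑b = Sum.elim (fun j : Fin m => -(J₀ x (fundamentalField (ξ j) x)))
      (fun j : Fin m => fundamentalField (ξ j) x) :=
    coe_basisOfLinearIndependentOfCardEqFinrank' _ hli hcard
  have hdt : ∀ (i : Fin m) (j : Fin m ⊕ Fin m),
      S.dt ξ J₀ i x (b j) = if j = Sum.inr i then 1 else 0 := fun i j => by
    rw [hb]
    refine dualCovector_apply _ _ ⟨LinearMap.toContinuousLinearMap (b.coord (Sum.inr i)), ?_⟩ j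
    intro j
    rw [← hb]
    simp [Finsupp.single_apply]
  have hdtK : ∀ i j, S.dt ξ J₀ i x (fundamentalField (ξ j) x) = if j = i then 1 else 0 :=
    fun i j => by simpa [hb] using hdt i (Sum.inr j)
  have hdmuK : ∀ i j, S.dmu ξ i x (fundamentalField (ξ j) x) = 0 :=
    fun i j => S.mvfderiv_μ_fundamentalField _ _ x
  have hspan : ∀ v, (∀ i, S.dt ξ J₀ i x v = 0) →
      ∃ η : TorusLie m, v = J₀ x (fundamentalField η x) := fun v hv => by
    have h1 := b.sum_repr v
    have h2 : ∀ i, b.repr v (Sum.inr i) = 0 := fun i => by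
      have h3 := hv i
      rw [← h1, map_sum] at h3
      simpa [hdt] using h3
    rw [Fintype.sum_sum_type] at h1
    simp only [h2, zero_smul, Finset.sum_const_zero, add_zero, hb, Sum.elim_inl] at h1
    refine ⟨∑ i, (-b.repr v (Sum.inl i)) • ξ i, ?_⟩
    have h4 : fundamentalField (∑ i, (-b.repr v (Sum.inl i)) • ξ i) x
        = ∑ i, (-b.repr v (Sum.inl i)) • fundamentalField (ξ i) x := by
      change S.infinitesimalAction x _ = _
      simp only [map_sum, map_smul]
      rfl
    rw [h4, map_sum]
    refine h1.symm.trans (Finset.sum_congr rfl fun i _ => ?_)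
    rw [map_smul, smul_neg, neg_smul]
  -- The common kernel of the `dt^i` is `J₀ 𝒦`. If `dμ` also kills `J₀ η♯`, then `Ω(η♯, J₀ η♯) = 0`,
  -- against taming unless `η♯ = 0`.
  have hker : ∀ v, (∀ i, S.dmu ξ i x v = 0) → (∀ i, S.dt ξ J₀ i x v = 0) → v = 0 := by
    intro v hμ ht
    obtain ⟨η, rfl⟩ := hspan v ht
    by_cases h0 : fundamentalField η x = 0
    · rw [h0, map_zero]
    · exfalso
      refine (htame _ h0).ne' ?_
      have h1 : ∀ i, S.Ω x (S.infinitesimalAction x (ξ i)) (J₀ x (fundamentalField η x)) = 0 :=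
        fun i => by
          have : S.Ω x (fundamentalField (ξ i) x) (J₀ x (fundamentalField η x)) = _ :=
            S.μ_hamiltonian (ξ i) x _
          exact this.trans (neg_eq_zero.2 (hμ i))
      have h2 : fundamentalField η x = ∑ i, ξ.repr η i • S.infinitesimalAction x (ξ i) := by
        change S.infinitesimalAction x η = _
        conv_lhs => rw [← ξ.sum_repr η]
        simp only [map_sum, map_smul]
      nth_rw 1 [h2]
      rw [map_sum, sum_apply]
      refine Finset.sum_eq_zero fun i _ => ?_
      rw [map_smul, smul_apply, h1, smul_zero]
  let Θ : TangentSpace (𝓡 (2 * m)) x →ₗ[ℝ] (Fin m ⊕ Fin m → ℝ) :=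
    LinearMap.pi (Sum.elim (fun i => (S.dmu ξ i x).toLinearMap)
      (fun i => (S.dt ξ J₀ i x).toLinearMap))
  have hΘinj : Function.Injective Θ := by
    rw [injective_iff_map_eq_zero]
    exact fun v hv => hker v (fun i => congrFun hv (Sum.inl i)) (fun i => congrFun hv (Sum.inr i))
  have hΘsurj : Function.Surjective Θ :=
    (LinearMap.injective_iff_surjective_of_finrank_eq_finrank
      (by rw [Module.finrank_fintype_fun_eq_card, hcard])).1 hΘinj
  have hp : ∀ (i : Fin m) (j : Fin m ⊕ Fin m),
      (Sum.elim (fun j : Fin m => S.dmu ξ j x) (fun j : Fin m => S.dt ξ J₀ j x)) j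
        (S.partialMu ξ J₀ i x) = if j = Sum.inl i then 1 else 0 := fun i j => by
    refine apply_dualVector _ _ ?_ j
    obtain ⟨v, hv⟩ := hΘsurj (fun j => if j = Sum.inl i then 1 else 0)
    refine ⟨v, ?_⟩
    rintro (j | j)
    · exact congrFun hv (Sum.inl j)
    · exact congrFun hv (Sum.inr j)
  have hdmup : ∀ i j, S.dmu ξ i x (S.partialMu ξ J₀ j x) = if i = j then 1 else 0 :=
    fun i j => by simpa using hp j (Sum.inl i)
  have hdtp : ∀ i j, S.dt ξ J₀ i x (S.partialMu ξ J₀ j x) = 0 :=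
    fun i j => by simpa using hp j (Sum.inr i)
  have hΩp : ∀ i j, S.Ω x (S.partialMu ξ J₀ i x) (S.partialMu ξ J₀ j x) = 0 := fun i j => by
    obtain ⟨η, hη⟩ := hspan _ fun k => hdtp k i
    obtain ⟨ζ, hζ⟩ := hspan _ fun k => hdtp k j
    rw [hη, hζ]
    refine S.Ω_map_fundamentalField (hJ₀.1.sq x (mem_univ x)) ?_ η ζ
    exact hJ₀.2 x ⟨mem_univ x, S.mem_regular_of_locallyFree hx⟩
  have hexp : ∀ v, v = ∑ i, S.dmu ξ i x v • S.partialMu ξ J₀ i x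
      + ∑ i, S.dt ξ J₀ i x v • fundamentalField (ξ i) x := fun v => by
    rw [← sub_eq_zero]
    refine hker _ (fun i => ?_) (fun i => ?_)
    · simp only [map_sub, map_add, map_sum, map_smul, hdmup, hdmuK, smul_eq_mul]
      simp
    · simp only [map_sub, map_add, map_sum, map_smul, hdtp, hdtK, smul_eq_mul]
      simp
  have hΩK : ∀ i v, S.Ω x (fundamentalField (ξ i) x) v = - S.dmu ξ i x v :=
    fun i v => S.μ_hamiltonian (ξ i) x v
  have hΩp' : ∀ i v, S.Ω x (S.partialMu ξ J₀ i x) v = S.dt ξ J₀ i x v := fun i v => by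
    conv_lhs => rw [hexp v]
    simp only [map_add, map_sum, map_smul, hΩp, S.Ω_swap x _ (fundamentalField _ x), hΩK, hdmup,
      smul_eq_mul, neg_neg]
    simp
  refine ⟨hdmuK, hdtK, hdmup, hdtp, fun v w => ?_⟩
  conv_lhs => rw [hexp v]
  simp only [map_add, map_sum, map_smul, add_apply, sum_apply,
    smul_apply, hΩp', hΩK, smul_eq_mul, dotProduct, mul_neg,
    Finset.sum_neg_distrib, sub_eq_add_neg]

variable {S ξ}

/-- An antidiagonal almost complex structure in terms of the components of vectors. -/
theorem HasAntiDiagonalForm.components {J₀ J : EndField m M} {Ψ : M → Matrix (Fin m) (Fin m) ℝ}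
    (hJ : S.HasAntiDiagonalForm ξ J₀ J Ψ) {x : M} (hx : x ∈ S.regular)
    (hF : S.IsDarbouxFrame ξ J₀ x) (v : TangentSpace (𝓡 (2 * m)) x) :
    ((fun i => S.dmu ξ i x (J x v)) = -((Ψ x)⁻¹ *ᵥ fun i => S.dt ξ J₀ i x v)) ∧
      ((fun i => S.dt ξ J₀ i x (J x v)) = Ψ x *ᵥ fun i => S.dmu ξ i x v) := by
  constructor
  · funext a
    rw [hJ x hx v]
    simp only [map_sub, map_sum, map_smul, hF.dmu_K, hF.dmu_partialMu, smul_eq_mul, Matrix.mulVec,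
      dotProduct, Pi.neg_apply]
    simp
  · funext a
    rw [hJ x hx v]
    simp only [map_sub, map_sum, map_smul, hF.dt_K, hF.dt_partialMu, smul_eq_mul, Matrix.mulVec,
      dotProduct]
    simp

theorem HasAntiDiagonalForm.Ω_apply {J₀ J : EndField m M} {Ψ : M → Matrix (Fin m) (Fin m) ℝ}
    (hJ : S.HasAntiDiagonalForm ξ J₀ J Ψ) {x : M} (hx : x ∈ S.regular)
    (hF : S.IsDarbouxFrame ξ J₀ x) (v w : TangentSpace (𝓡 (2 * m)) x) :
    S.Ω x v (J x w) = (fun i => S.dmu ξ i x v) ⬝ᵥ (Ψ x *ᵥ fun i => S.dmu ξ i x w)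
      + (fun i => S.dt ξ J₀ i x v) ⬝ᵥ ((Ψ x)⁻¹ *ᵥ fun i => S.dt ξ J₀ i x w) := by
  obtain ⟨h1, h2⟩ := hJ.components hx hF w
  rw [hF.Ω_eq, h1, h2, dotProduct_neg, sub_neg_eq_add]

/-- The matrix inverse in the antidiagonal form could be the default one of a singular matrix;
comparing the `dμ` components of `J (J v) = -v` shows that it is not. -/
theorem HasAntiDiagonalForm.inv_mul {J₀ J : EndField m M} {Ψ : M → Matrix (Fin m) (Fin m) ℝ}
    (hJ : S.HasAntiDiagonalForm ξ J₀ J Ψ) {x : M} (hx : x ∈ S.regular)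
    (hF : S.IsDarbouxFrame ξ J₀ x) (hsq : ∀ v, J x (J x v) = -v) : (Ψ x)⁻¹ * Ψ x = 1 := by
  apply Matrix.mulVec_injective
  funext p
  let v := ∑ i, p i • S.partialMu ξ J₀ i x
  have hv : (fun i => S.dmu ξ i x v) = p := by
    funext i
    simp [v, map_sum, hF.dmu_partialMu]
  have h1 := (hJ.components hx hF (J x v)).1
  rw [hsq, (hJ.components hx hF v).2, hv] at h1
  simp only [map_neg] at h1
  rw [Matrix.one_mulVec, ← Matrix.mulVec_mulVec]
  funext i
  have h2 := congrFun h1 i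
  rw [Pi.neg_apply, neg_inj] at h2
  rw [← h2, ← hv]

variable (S ξ) in
/-- The bilinear form `Ω(·, J ·) + ∑ A_{ij} dμ^i ⊗ dμ^j + ∑ B_{ij} (J dμ^i) ⊗ (J dμ^j)`, with its
arguments exchanged. -/
noncomputable def compactifiedBilin (J : EndField m M)
    (A B : TorusLieDual m → Matrix (Fin m) (Fin m) ℝ) : BilinField m M := fun x =>
  -- The sign comes from exchanging the arguments: `-Ω(J w, v) = Ω(v, J w)`. The two signs in `J dμ
  -- = -dμ ∘ J` cancel below.
  -(S.Ω x ∘L J x)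
    + ∑ i, ∑ j, A (S.μ x) i j • (S.dmu ξ j x).smulRight (S.dmu ξ i x)
    + ∑ i, ∑ j, B (S.μ x) i j • (S.dmu ξ j x ∘L J x).smulRight (S.dmu ξ i x ∘L J x)

theorem compactifiedBilin_apply (J : EndField m M)
    (A B : TorusLieDual m → Matrix (Fin m) (Fin m) ℝ) (x : M)
    (w v : TangentSpace (𝓡 (2 * m)) x) :
    S.compactifiedBilin ξ J A B x w v = S.Ω x v (J x w)
      + ∑ i, ∑ j, A (S.μ x) i j * S.dmu ξ i x v * S.dmu ξ j x w
      + ∑ i, ∑ j, B (S.μ x) i j * S.dmu ξ i x (J x v) * S.dmu ξ j x (J x w) := by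
  rw [S.Ω_swap x v]
  simp only [compactifiedBilin, add_apply, neg_apply, sum_apply,
    smul_apply, ContinuousLinearMap.comp_apply,
    ContinuousLinearMap.smulRight_apply, smul_eq_mul]
  congr 1
  · congr 1
    exact Finset.sum_congr rfl fun i _ => Finset.sum_congr rfl fun j _ => by ring
  · exact Finset.sum_congr rfl fun i _ => Finset.sum_congr rfl fun j _ => by ring

theorem compactifiedBilin_self (J : EndField m M)
    (A B : TorusLieDual m → Matrix (Fin m) (Fin m) ℝ) (x : M) (v : TangentSpace (𝓡 (2 * m)) x) :
    S.compactifiedBilin ξ J A B x v v = S.compactifiedForm ξ J A B x v := by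
  rw [compactifiedBilin_apply, compactifiedForm]
  simp only [mul_neg, neg_mul, neg_neg]

/-- At the points with discrete stabilizer the compactified form is `Ω(·, Jreg ·)`. -/
theorem compactifiedBilin_eq {J₀ J Jreg : EndField m M} {Ψ Ψreg : M → Matrix (Fin m) (Fin m) ℝ}
    {A B : TorusLieDual m → Matrix (Fin m) (Fin m) ℝ}
    (hJ : S.HasAntiDiagonalForm ξ J₀ J Ψ) (hJreg : S.HasAntiDiagonalForm ξ J₀ Jreg Ψreg)
    (C1 : S.IsSmoothExtension (fun x => Ψreg x - Ψ x) A)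
    (C2 : S.IsSmoothExtension (fun x => (Ψ x)ᵀ * (Ψreg x)⁻¹ * Ψ x - (Ψ x)ᵀ) B)
    {x : M} (hx : x ∈ S.regular) (hF : S.IsDarbouxFrame ξ J₀ x) (hsq : ∀ v, J x (J x v) = -v)
    (v w : TangentSpace (𝓡 (2 * m)) x) :
    S.compactifiedBilin ξ J A B x w v = S.Ω x v (Jreg x w) := by
  have hsum : ∀ (C : Matrix (Fin m) (Fin m) ℝ) (p q : Fin m → ℝ),
      ∑ i, ∑ j, C i j * p i * q j = p ⬝ᵥ (C *ᵥ q) := fun C p q => by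
    simp only [dotProduct, Matrix.mulVec, Finset.mul_sum]
    exact Finset.sum_congr rfl fun i _ => Finset.sum_congr rfl fun j _ => by ring
  -- The `A` term adds `Ψreg - Ψ` to the `dμ` block, and the `B` term, evaluated on `-Ψ⁻¹ dt`, adds
  -- `Ψreg⁻¹ - Ψ⁻¹` to the `dt` block.
  rw [compactifiedBilin_apply, hsum (A (S.μ x)) (fun i => S.dmu ξ i x v) (fun i => S.dmu ξ i x w),
    hsum (B (S.μ x)) (fun i => S.dmu ξ i x (J x v)) (fun i => S.dmu ξ i x (J x w)),
    (hJ.components hx hF v).1, (hJ.components hx hF w).1, ← C1.2 x hx, ← C2.2 x hx,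
    Matrix.mulVec_neg, neg_dotProduct_neg, dotProduct_congruence_sub (hJ.inv_mul hx hF hsq),
    hJ.Ω_apply hx hF, hJreg.Ω_apply hx hF, Matrix.sub_mulVec, dotProduct_sub]
  ring

end SymplecticToric

/-! ### Closed conditions on smooth tensor fields. -/

section Coordinates

variable {m : ℕ} {M : Type*} [TopologicalSpace M] [ChartedSpace (EuclideanSpace ℝ (Fin (2 * m))) M]
  [IsManifold (𝓡 (2 * m)) ∞ M]

omit [IsManifold (𝓡 (2 * m)) ∞ M] in
theorem contMDiffAt_finset_sum_sum {F : Type*} [NormedAddCommGroup F] [NormedSpace ℝ F]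
    {ι : Type*} [Fintype ι] {f : ι → ι → M → F} {x₀ : M}
    (h : ∀ i j, ContMDiffAt (𝓡 (2 * m)) 𝓘(ℝ, F) ∞ (f i j) x₀) :
    ContMDiffAt (𝓡 (2 * m)) 𝓘(ℝ, F) ∞ (fun x => ∑ i, ∑ j, f i j x) x₀ :=
  contMDiffAt_finsetSum fun i _ => contMDiffAt_finsetSum fun j _ => h i j

omit [IsManifold (𝓡 (2 * m)) ∞ M] in
set_option synthInstance.maxHeartbeats 200000 in
theorem ContMDiffAt.clm_smulRight {F G : Type*} [NormedAddCommGroup F] [NormedSpace ℝ F]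
    [NormedAddCommGroup G] [NormedSpace ℝ G] {α : M → F →L[ℝ] ℝ} {w : M → G} {x₀ : M}
    (hα : ContMDiffAt (𝓡 (2 * m)) 𝓘(ℝ, F →L[ℝ] ℝ) ∞ α x₀)
    (hw : ContMDiffAt (𝓡 (2 * m)) 𝓘(ℝ, G) ∞ w x₀) :
    ContMDiffAt (𝓡 (2 * m)) 𝓘(ℝ, F →L[ℝ] G) ∞ (fun x => (α x).smulRight (w x)) x₀ :=
  ((contMDiffAt_const (c := ContinuousLinearMap.smulRightL ℝ F G)).clm_apply hα).clm_apply hw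

/-- A smooth vector field vanishing at points arbitrarily near to a point vanishes there. -/
theorem VField.eq_zero_of_frequently {X : VField m M} {x₀ : M}
    (hX : ContMDiffAt (𝓡 (2 * m)) ((𝓡 (2 * m)).prod (𝓡 (2 * m))) 0
      (fun x => TotalSpace.mk' (EuclideanSpace ℝ (Fin (2 * m))) x (X x)) x₀)
    (h : ∃ᶠ x in nhds x₀, X x = 0) : X x₀ = 0 := by
  have h1 := ((contMDiffAt_section x₀).1 hX).continuousAt
  have h2 : ContinuousAt (fun x => toCoord x₀ x (X x)) x₀ := by
    refine h1.congr ?_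
    filter_upwards [coordDomain_eventually (m := m) x₀] with x hx
    exact (Trivialization.continuousLinearMapAt_apply_of_mem ℝ _ hx _).symm
  have h3 : toCoord x₀ x₀ (X x₀) = 0 := by
    by_contra hne
    refine h ?_
    filter_upwards [h2.eventually_ne hne] with x hx hx'
    exact hx (by rw [hx', map_zero])
  rw [← ofCoord_toCoord (mem_coordDomain x₀) (X x₀), h3, map_zero]

theorem EndField.SmoothOn.app {J : EndField m M} {X : VField m M} {U : Set M} (hJ : J.SmoothOn U)
    (hX : X.SmoothOn U) : (J.app X).SmoothOn U :=
  ContMDiffOn.clm_bundle_apply (E₁ := (TangentSpace (𝓡 (2 * m)) : M → Type _))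
    (E₂ := (TangentSpace (𝓡 (2 * m)) : M → Type _)) hJ hX

/-- The Nijenhuis tensor of smooth data is continuous. -/
theorem contMDiffAt_nijenhuis {J : EndField m M} {X Y : VField m M} (hJ : J.SmoothOn univ)
    (hX : X.SmoothOn univ) (hY : Y.SmoothOn univ) (x₀ : M) :
    ContMDiffAt (𝓡 (2 * m)) ((𝓡 (2 * m)).prod (𝓡 (2 * m))) 0
      (fun x => TotalSpace.mk' (EuclideanSpace ℝ (Fin (2 * m))) x (nijenhuis J X Y x)) x₀ := by
  have : IsManifold (𝓡 (2 * m)) (((1 : ℕ∞) : WithTop ℕ∞) + 1) M :=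
    IsManifold.of_le (n := ∞) (by exact_mod_cast le_top)
  have : IsManifold (𝓡 (2 * m)) (minSmoothness ℝ 2) M := by
    rw [minSmoothness_of_isRCLikeNormedField]
    exact IsManifold.of_le (n := ∞) (WithTop.coe_le_coe.2 le_top)
  have hbr : ∀ {Z W : VField m M}, Z.SmoothOn univ → W.SmoothOn univ →
      ContMDiffAt (𝓡 (2 * m)) ((𝓡 (2 * m)).prod (𝓡 (2 * m))) 0
      (fun x => TotalSpace.mk' (EuclideanSpace ℝ (Fin (2 * m))) x
        (VectorField.mlieBracket (𝓡 (2 * m)) Z W x)) x₀ := fun {Z W} hZ hW => by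
    have hZ' := (ContMDiffOn.contMDiffAt hZ (x := x₀) Filter.univ_mem).of_le
      (show ((1 : ℕ∞) : WithTop ℕ∞) ≤ ∞ by exact_mod_cast le_top)
    have hW' := (ContMDiffOn.contMDiffAt hW (x := x₀) Filter.univ_mem).of_le
      (show ((1 : ℕ∞) : WithTop ℕ∞) ≤ ∞ by exact_mod_cast le_top)
    exact ContMDiffAt.mlieBracket_vectorField (m := 0) (n := 1) hZ' hW' (by simp)
  have hJ' := (ContMDiffOn.contMDiffAt hJ (x := x₀) Filter.univ_mem).of_le
    (show (0 : WithTop ℕ∞) ≤ ∞ by exact_mod_cast bot_le)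
  have happ : ∀ {Z : VField m M}, ContMDiffAt (𝓡 (2 * m)) ((𝓡 (2 * m)).prod (𝓡 (2 * m))) 0
      (fun x => TotalSpace.mk' (EuclideanSpace ℝ (Fin (2 * m))) x (Z x)) x₀ →
      ContMDiffAt (𝓡 (2 * m)) ((𝓡 (2 * m)).prod (𝓡 (2 * m))) 0
      (fun x => TotalSpace.mk' (EuclideanSpace ℝ (Fin (2 * m))) x (J x (Z x))) x₀ := fun {Z} hZ =>
    ContMDiffAt.clm_bundle_apply (E₁ := (TangentSpace (𝓡 (2 * m)) : M → Type _))
      (E₂ := (TangentSpace (𝓡 (2 * m)) : M → Type _)) hJ' hZ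
  exact (((hbr (hJ.app hX) (hJ.app hY)).sub_section (happ (hbr (hJ.app hX) hY))).sub_section
    (happ (hbr hX (hJ.app hY)))).sub_section (hbr hX hY)

/-- Integrability of a smooth field of endomorphisms follows from integrability of its restriction
to a dense open set. -/
theorem EndField.integrableOn_univ_of_dense {J J' : EndField m M} {U : Set M} (hU : IsOpen U)
    (hd : Dense U) (hJ : J.SmoothOn univ) (hJJ' : ∀ x ∈ U, J x = J' x) (hJ' : J'.IntegrableOn U) :
    J.IntegrableOn univ := by
  intro X Y hX hY x _
  refine VField.eq_zero_of_frequently (contMDiffAt_nijenhuis hJ hX hY x) ?_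
  refine (mem_closure_iff_frequently.1 (hd x)).mono fun y hy => ?_
  rw [← hJ' X Y (hX.mono (subset_univ U)) (hY.mono (subset_univ U)) y hy]
  -- Lie brackets depend only on germs, so `J` may be replaced by `J'` near a point of the open set
  -- `U`.
  have happ : ∀ Z : VField m M, J.app Z =ᶠ[nhds y] J'.app Z := fun Z => by
    filter_upwards [hU.mem_nhds hy] with z hz
    change J z (Z z) = J' z (Z z)
    rw [hJJ' z hz]
  simp only [nijenhuis, hJJ' y hy]
  rw [(happ X).mlieBracket_vectorField_eq (happ Y),
    (happ X).mlieBracket_vectorField_eq (Filter.EventuallyEq.refl _ Y),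
    (Filter.EventuallyEq.refl _ X).mlieBracket_vectorField_eq (happ Y)]

/-- A smooth field of endomorphisms whose square is `-1` on a dense set is an almost complex
structure. -/
theorem EndField.sq_eq_neg_of_dense {J : EndField m M} (hJ : J.SmoothOn univ) {U : Set M} (hU : Dense U)
    (h : ∀ x ∈ U, ∀ v, J x (J x v) = -v) (x₀ : M) (v : TangentSpace (𝓡 (2 * m)) x₀) :
    J x₀ (J x₀ v) = -v := by
  have hJ' := (EndField.smoothOn_iff _ isOpen_univ).1 hJ x₀ (mem_univ x₀)
  let J₁ : EndField m M := fun x => J x ∘L J x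
  let J₂ : EndField m M := fun x => -ContinuousLinearMap.id ℝ _
  have h1 : ContinuousAt (J₁.coord x₀) x₀ := by
    refine (hJ'.clm_comp hJ').continuousAt.congr ?_
    filter_upwards [coordDomain_eventually (m := m) x₀] with x hx
    ext1 u
    simp only [EndField.coord, J₁, ContinuousLinearMap.comp_apply, ofCoord_toCoord hx]
  have h2 : ContinuousAt (J₂.coord x₀) x₀ := by
    refine (continuousAt_const (y := -ContinuousLinearMap.id ℝ
      (EuclideanSpace ℝ (Fin (2 * m))))).congr ?_
    filter_upwards [coordDomain_eventually (m := m) x₀] with x hx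
    ext1 u
    change -u = toCoord x₀ x (-ofCoord x₀ x u)
    rw [map_neg, toCoord_ofCoord hx]
  have h3 : J₁ x₀ = J₂ x₀ := EndField.eq_of_frequently_eq h1 h2
    ((mem_closure_iff_frequently.1 (hU x₀)).mono fun x hx => by
      ext1 u
      exact h x hx u)
  exact congrArg (fun f : TangentSpace (𝓡 (2 * m)) x₀ →L[ℝ] TangentSpace (𝓡 (2 * m)) x₀ => f v) h3

end Coordinates

/-! ### The extended structure and its smoothness. -/

namespace SymplecticToric

variable {m : ℕ} {M : Type*} [TopologicalSpace M] [ChartedSpace (EuclideanSpace ℝ (Fin (2 * m))) M]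
  [IsManifold (𝓡 (2 * m)) ∞ M] [MulAction (Torus m) M] (S : SymplecticToric m M)

theorem isOpen_regular : IsOpen S.regular :=
  isOpen_interior.preimage S.μ_smooth.continuous

theorem dense_regular [T2Space M] [CompactSpace M] [PreconnectedSpace M] : Dense S.regular :=
  S.dense_locallyFree.mono fun _ hx => S.mem_regular_of_locallyFree hx

-- The relation `Ω(J^{*Ω} v, w) = Ω(v, J w)` determines the adjoint from smooth data. Smoothness is
-- what lets its integrability pass from `M°` to `M`.
set_option synthInstance.maxHeartbeats 200000 in
theorem adjoint_smoothOn {J : EndField m M} (hJ : J.SmoothOn univ) :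
    (S.adjoint J).SmoothOn univ := by
  rw [EndField.smoothOn_iff _ isOpen_univ] at hJ ⊢
  intro x₀ _
  let c : BilinField m M := fun x => ContinuousLinearMap.precomp ℝ (J x) ∘L S.Ω x
  have hc : ContMDiffAt (𝓡 (2 * m))
      𝓘(ℝ, EuclideanSpace ℝ (Fin (2 * m)) →L[ℝ] EuclideanSpace ℝ (Fin (2 * m)) →L[ℝ] ℝ) ∞
      (c.coord x₀) x₀ := by
    have h1 := ((contMDiffAt_const (c := (ContinuousLinearMap.compL ℝ (EuclideanSpace ℝ (Fin (2 * m)))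
      (EuclideanSpace ℝ (Fin (2 * m))) ℝ).flip)).clm_apply (hJ x₀ (mem_univ _))).clm_comp
      (S.Ω_smooth.contMDiffAt_coord x₀)
    refine h1.congr_of_eventuallyEq ?_
    filter_upwards [coordDomain_eventually (m := m) x₀] with x hx
    ext u v
    simp only [ContinuousLinearMap.comp_apply, ContinuousLinearMap.flip_apply,
      ContinuousLinearMap.compL_apply, BilinField.coord_apply, EndField.coord,
      ofCoord_toCoord hx]
    rfl
  exact EndField.contMDiffAt_coord_of_bilin S.Ω_smooth S.Ω_nondegenerate hc
    (Filter.Eventually.of_forall fun x v w => S.adjoint_apply J x v w)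

variable (ξ : Module.Basis (Fin m) ℝ (TorusLie m))

theorem contMDiff_μ_apply (η : TorusLie m) : ContMDiff (𝓡 (2 * m)) 𝓘(ℝ, ℝ) ∞ (fun y => S.μ y η) :=
  (ContinuousLinearMap.apply ℝ ℝ η).contMDiff.comp S.μ_smooth

theorem contMDiffAt_dmu_coord (i : Fin m) (x₀ : M) :
    ContMDiffAt (𝓡 (2 * m)) 𝓘(ℝ, EuclideanSpace ℝ (Fin (2 * m)) →L[ℝ] ℝ) ∞
      (fun x => S.dmu ξ i x ∘L ofCoord x₀ x) x₀ :=
  contMDiffAt_mvfderiv_coord (S.contMDiff_μ_apply (ξ i)) x₀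

theorem contMDiffAt_compactifiedBilin_coord {J : EndField m M} (hJ : J.SmoothOn univ)
    {A B : TorusLieDual m → Matrix (Fin m) (Fin m) ℝ}
    (hA : ∀ i j, ContDiff ℝ ∞ (fun p => A p i j)) (hB : ∀ i j, ContDiff ℝ ∞ (fun p => B p i j))
    (x₀ : M) :
    ContMDiffAt (𝓡 (2 * m))
      𝓘(ℝ, EuclideanSpace ℝ (Fin (2 * m)) →L[ℝ] EuclideanSpace ℝ (Fin (2 * m)) →L[ℝ] ℝ) ∞
      ((S.compactifiedBilin ξ J A B).coord x₀) x₀ := by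
  have hJ' := (EndField.smoothOn_iff _ isOpen_univ).1 hJ x₀ (mem_univ x₀)
  have hd := fun i => S.contMDiffAt_dmu_coord ξ i x₀
  have hdJ := fun i => (hd i).clm_comp hJ'
  have hA' := fun i j => ((hA i j).contMDiff.comp S.μ_smooth) x₀
  have hB' := fun i j => ((hB i j).contMDiff.comp S.μ_smooth) x₀
  have h := ((((S.Ω_smooth.contMDiffAt_coord x₀).clm_comp hJ').neg).add
    (contMDiffAt_finset_sum_sum fun i j => (hA' i j).smul ((hd j).clm_smulRight (hd i)))).add
    (contMDiffAt_finset_sum_sum fun i j => (hB' i j).smul ((hdJ j).clm_smulRight (hdJ i)))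
  refine h.congr_of_eventuallyEq ?_
  filter_upwards [coordDomain_eventually (m := m) x₀] with x hx
  ext u v
  simp only [BilinField.coord_apply, compactifiedBilin, EndField.coord, Pi.add_apply, Pi.smul_apply',
    add_apply, neg_apply, sum_apply, smul_apply, ContinuousLinearMap.comp_apply, Function.comp,
    ContinuousLinearMap.smulRight_apply, ofCoord_toCoord hx]

/-- The almost complex structure `Ω`-associated to the compactified form. -/
noncomputable def compactification (J : EndField m M)
    (A B : TorusLieDual m → Matrix (Fin m) (Fin m) ℝ) : EndField m M := fun x =>
  -- The inverse solves for the first argument of `Ω`, while the defining relation has the unknown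
  -- in the second; hence the sign.
  -((S.Ω x).inverse ∘L S.compactifiedBilin ξ J A B x)

theorem Ω_compactification (J : EndField m M)
    (A B : TorusLieDual m → Matrix (Fin m) (Fin m) ℝ) (x : M)
    (v w : TangentSpace (𝓡 (2 * m)) x) :
    S.Ω x v (S.compactification ξ J A B x w) = S.compactifiedBilin ξ J A B x w v := by
  have : FiniteDimensional ℝ (TangentSpace (𝓡 (2 * m)) x) :=
    inferInstanceAs (FiniteDimensional ℝ (EuclideanSpace ℝ (Fin (2 * m))))
  have : T2Space (TangentSpace (𝓡 (2 * m)) x) :=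
    inferInstanceAs (T2Space (EuclideanSpace ℝ (Fin (2 * m))))
  change S.Ω x v (-((S.Ω x).inverse (S.compactifiedBilin ξ J A B x w))) = _
  rw [map_neg, S.Ω_swap, neg_neg, inverse_apply_of_nondegenerate (S.Ω_nondegenerate x)]

set_option synthInstance.maxHeartbeats 200000 in
theorem compactification_smoothOn {J : EndField m M} (hJ : J.SmoothOn univ)
    {A B : TorusLieDual m → Matrix (Fin m) (Fin m) ℝ}
    (hA : ∀ i j, ContDiff ℝ ∞ (fun p => A p i j)) (hB : ∀ i j, ContDiff ℝ ∞ (fun p => B p i j)) :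
    (S.compactification ξ J A B).SmoothOn univ := by
  rw [EndField.smoothOn_iff _ isOpen_univ]
  intro x₀ _
  refine EndField.contMDiffAt_coord_of_bilin S.Ω_smooth S.Ω_nondegenerate
    (c := -S.compactifiedBilin ξ J A B)
    ((S.contMDiffAt_compactifiedBilin_coord ξ hJ hA hB x₀).neg.congr_of_eventuallyEq ?_)
    (Filter.Eventually.of_forall fun x v w => ?_)
  · refine Filter.Eventually.of_forall fun x => ?_
    ext u v
    rfl
  · rw [S.Ω_swap, S.Ω_compactification]
    rfl

theorem Ω_right_cancel {x : M} {v w : TangentSpace (𝓡 (2 * m)) x}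
    (h : ∀ u, S.Ω x u v = S.Ω x u w) : v = w := by
  apply S.Ω_injective x
  ext u
  rw [S.Ω_swap x v, S.Ω_swap x w, h]

end SymplecticToric

/-! ### Invariance under the torus. -/

namespace SymplecticToric

variable {m : ℕ} {M : Type*} [TopologicalSpace M] [ChartedSpace (EuclideanSpace ℝ (Fin (2 * m))) M]
  [IsManifold (𝓡 (2 * m)) ∞ M] [MulAction (Torus m) M] (S : SymplecticToric m M)

/-- The differential at `x` of the action of `g`. -/
noncomputable def actionDeriv (g : Torus m) (x : M) :
    TangentSpace (𝓡 (2 * m)) x →L[ℝ] TangentSpace (𝓡 (2 * m)) (g • x) :=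
  mfderiv (𝓡 (2 * m)) (𝓡 (2 * m)) (fun y : M => g • y) x

-- Preserving a nondegenerate form forces injectivity, and the dimensions agree.
include S in
theorem actionDeriv_surjective (g : Torus m) (x : M) :
    Function.Surjective (actionDeriv (m := m) g x) := by
  have hinj : Function.Injective (actionDeriv (m := m) g x) := by
    rw [injective_iff_map_eq_zero]
    intro v hv
    refine S.Ω_nondegenerate x v fun w => ?_
    rw [← S.action_symplectic g x v w]
    change S.Ω (g • x) (actionDeriv g x v) _ = 0
    rw [hv, map_zero]
    rfl
  have : FiniteDimensional ℝ (TangentSpace (𝓡 (2 * m)) x) :=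
    inferInstanceAs (FiniteDimensional ℝ (EuclideanSpace ℝ (Fin (2 * m))))
  have : FiniteDimensional ℝ (TangentSpace (𝓡 (2 * m)) (g • x)) :=
    inferInstanceAs (FiniteDimensional ℝ (EuclideanSpace ℝ (Fin (2 * m))))
  exact (LinearMap.injective_iff_surjective_of_finrank_eq_finrank
    (f := (actionDeriv (m := m) g x).toLinearMap) rfl).1 hinj

variable (ξ : Module.Basis (Fin m) ℝ (TorusLie m))

theorem dmu_actionDeriv (i : Fin m) (g : Torus m) (x : M) (v : TangentSpace (𝓡 (2 * m)) x) :
    S.dmu ξ i (g • x) (actionDeriv g x v) = S.dmu ξ i x v := by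
  have h1 := ((S.contMDiff_μ_apply (ξ i) (g • x)).mdifferentiableAt (by simp)).hasMFDerivAt
  have h2 := ((S.contMDiff_smul g x).mdifferentiableAt (by simp)).hasMFDerivAt
  have h3 := (HasMFDerivAt.comp (f := fun y : M => g • y) x h1 h2).mfderiv
  have h4 : (fun y => S.μ y (ξ i)) ∘ (fun y : M => g • y) = fun y => S.μ y (ξ i) := by
    funext y
    simp only [Function.comp, S.μ_invariant]
  rw [h4] at h3
  exact (congrArg (fun f : EuclideanSpace ℝ (Fin (2 * m)) →L[ℝ] ℝ => f v) h3).symm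

/-- Every term of the form is invariant; surjectivity of `actionDeriv` lets the test vectors at `g •
x` come from `x`. -/
theorem compactification_invariant {J : EndField m M}
    (hJ : ∀ (g : Torus m) (x : M) (v : TangentSpace (𝓡 (2 * m)) x),
      J (g • x) (actionDeriv g x v) = actionDeriv g x (J x v))
    (A B : TorusLieDual m → Matrix (Fin m) (Fin m) ℝ) (g : Torus m) (x : M)
    (v : TangentSpace (𝓡 (2 * m)) x) :
    S.compactification ξ J A B (g • x) (actionDeriv g x v)
      = actionDeriv g x (S.compactification ξ J A B x v) := by
  have hΩ : ∀ u w, S.Ω (g • x) (actionDeriv g x u) (actionDeriv g x w) = S.Ω x u w :=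
    S.action_symplectic g x
  refine S.Ω_right_cancel fun u => ?_
  obtain ⟨u, rfl⟩ := S.actionDeriv_surjective g x u
  rw [hΩ, S.Ω_compactification, S.Ω_compactification, compactifiedBilin_apply,
    compactifiedBilin_apply]
  simp only [hJ, hΩ, S.dmu_actionDeriv, S.μ_invariant]

end SymplecticToric

/-! ### The extension theorem. -/

theorem theorem3p10 {m : ℕ} {M : Type*} [TopologicalSpace M] [T2Space M] [CompactSpace M]
    [ConnectedSpace M] [ChartedSpace (EuclideanSpace ℝ (Fin (2 * m))) M]
    [IsManifold (𝓡 (2 * m)) ∞ M] [MulAction (Torus m) M] (S : SymplecticToric m M)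
    (ξ : Module.Basis (Fin m) ℝ (TorusLie m))
    -- the structure inducing the admissible coordinates
    (J₀ : EndField m M) (hJ₀ : S.IsDGK univ J₀)
    (J : EndField m M) (hJ : S.IsDGK univ J)
    (Ψ : M → Matrix (Fin m) (Fin m) ℝ) (hΨ : S.HasAntiDiagonalForm ξ J₀ J Ψ)
    -- the structure on `M°`; its values elsewhere are irrelevant
    (Jreg : EndField m M) (hJreg : S.IsDGAK S.regular Jreg)
    (Ψreg : M → Matrix (Fin m) (Fin m) ℝ) (hΨreg : S.HasAntiDiagonalForm ξ J₀ Jreg Ψreg)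
    (A B : TorusLieDual m → Matrix (Fin m) (Fin m) ℝ)
    (C1 : S.IsSmoothExtension (fun x => Ψreg x - Ψ x) A)
    (C2 : S.IsSmoothExtension (fun x => (Ψ x)ᵀ * (Ψreg x)⁻¹ * Ψ x - (Ψ x)ᵀ) B)
    (C3 : ∀ x, x ∉ S.regular → ∀ v : TangentSpace (𝓡 (2 * m)) x, v ≠ 0 →
      0 < S.compactifiedForm ξ J A B x v) :
    ∃ Jext : EndField m M, S.IsDGAK univ Jext ∧ (∀ x ∈ S.regular, Jext x = Jreg x) ∧
      (S.IsDGK S.regular Jreg → S.IsDGK univ Jext) := by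
  have hsm := S.compactification_smoothOn ξ hJ.1.smooth C1.1 C2.1
  -- The frame computation applies only at locally free points. These accumulate at every point of
  -- `M°`, where both fields are continuous.
  have hext : ∀ x ∈ S.regular, S.compactification ξ J A B x = Jreg x := fun x₀ hx₀ => by
    refine EndField.eq_of_frequently_eq
      ((EndField.smoothOn_iff _ isOpen_univ).1 hsm x₀ (mem_univ x₀)).continuousAt
      ((EndField.smoothOn_iff _ S.isOpen_regular).1 hJreg.1.smooth x₀ hx₀).continuousAt
      ((mem_closure_iff_frequently.1 (S.dense_locallyFree x₀)).mono fun x hx => ?_)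
    ext1 v
    refine S.Ω_right_cancel fun u => ?_
    rw [S.Ω_compactification]
    exact S.compactifiedBilin_eq hΨ hΨreg C1 C2 (S.mem_regular_of_locallyFree hx)
      (S.isDarbouxFrame ξ ⟨hJ₀.1.toIsGAK, hJ₀.2⟩ hx) (hJ.1.sq x (mem_univ x)) u v
  have hal : S.AdjointAligned univ (S.compactification ξ J A B) := fun x hx => by
    have h := hJreg.2 x ⟨hx.2, hx.2⟩
    simp only [SymplecticToric.adjoint] at h ⊢
    rw [hext x hx.2]
    exact h
  have hgak : S.IsGAK univ (S.compactification ξ J A B) := by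
    refine ⟨hsm, fun x _ => EndField.sq_eq_neg_of_dense hsm S.dense_regular (fun x hx v => ?_) x,
      fun x _ v hv => ?_, fun g x _ v => ?_⟩
    · rw [hext x hx]
      exact hJreg.1.sq x hx v
    -- (C3) is only assumed off `M°`; on `M°` positivity comes from `Jreg`.
    · by_cases hx : x ∈ S.regular
      · rw [hext x hx]
        exact hJreg.1.tamed x hx v hv
      · rw [S.Ω_compactification, SymplecticToric.compactifiedBilin_self]
        exact C3 x hx v hv
    · exact S.compactification_invariant ξ (fun g x => hJ.1.invariant g x (mem_univ x)) A B g x v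
  refine ⟨S.compactification ξ J A B, ⟨hgak, hal⟩, hext, fun h => ⟨⟨hgak, ?_, ?_⟩, hal⟩⟩
  · exact EndField.integrableOn_univ_of_dense S.isOpen_regular S.dense_regular hsm hext
      h.1.integrable
  · refine EndField.integrableOn_univ_of_dense S.isOpen_regular S.dense_regular
      (S.adjoint_smoothOn hsm) (fun x hx => ?_) h.1.integrable_adjoint
    simp only [SymplecticToric.adjoint, hext x hx]
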